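/- Let $n\ge 1$ be an integer. For $\kappa\in(0,2]$ let $\boldsymbol B_\kappa=(B_{1,\kappa},\dots,B_{n,\kappa})$, where $B_{1,\kappa},\dots,B_{n,\kappa}$ are mutually independent standard fractional Brownian motions on $\mathbb R$ with common Hurst index $\kappa/2$, that is, centered Gaussian processes with almost surely continuous sample paths and covariance $\operatorname{Cov}(B_{i,\kappa}(s),B_{i,\kappa}(t))=\frac12\left(|s|^\kappa+|t|^\kappa-|t-s|^\kappa\right)$. For $S>0$ put $$\mathcal H_{\boldsymbol B_\kappa}(S)=\int_{\mathbb R^n}e^{\sum_{i=1}^n w_i}\,\mathbb P\left(\exists\, t\in[0,S]\ \forall\, 1\le i\le n:\ \sqrt2\,B_{i,\kappa}(t)-\operatorname{Var}(B_{i,\kappa}(t))>w_i\right)d\boldsymbol w,$$ and define the $n$-dimensional Pickands constant (with identity coefficients) by $$\mathcal H_{\boldsymbol B_\kappa}=\lim_{S\to\infty}S^{-1}\mathcal H_{\boldsymbol B_\kappa}(S).$$ Then, for $\kappa=1$ and $\kappa=2$, this limit exists and is finite, and $$\mathcal H_{\boldsymbol B_1}\le n\left(\frac{n}{n-1}\left(2+\sqrt{\frac{2}{\pi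 e}}\right)\right)^{n-1}\qquad\text{and}\qquad \mathcal H_{\boldsymbol B_2}\le n\left(\frac{n}{n-1}\right)^{n-1}\frac1{\sqrt\pi},$$ where $n/(n-1)$ is set to be $1$ for $n=1$. -/

import Mathlib

open MeasureTheory ProbabilityTheory Filter Topology
open scoped ENNReal

/-- `X` is a standard fractional Brownian motion on `ℝ` with Hurst index `κ / 2`, where
`κ ∈ (0, 2]`: a centered Gaussian process with almost surely continuous sample paths and
covariance function `(|s|^κ + |t|^κ - |t - s|^κ) / 2`. -/
structure IsStandardFBM {Ω : Type*} [MeasurableSpace Ω] (P : Measure Ω) (κ : ℝ)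
    (X : ℝ → Ω → ℝ) : Prop where
  gaussian : IsGaussianProcess X P
  centered : ∀ t, ∫ ω, X t ω ∂P = 0
  covariance : ∀ s t, cov[X s, X t; P] = (|s| ^ κ + |t| ^ κ - |t - s| ^ κ) / 2
  continuous_paths : ∀ᵐ ω ∂P, Continuous fun t => X t ω

/-- `B = (B 1, …, B n)` is a vector of `n` mutually independent standard fractional Brownian
motions with common Hurst index `κ / 2`. Independence is that of the whole processes, i.e. of the
`σ`-algebras generated by the families `(B i t)` for `t ∈ ℝ`. -/
structure IsVectorFBM {Ω : Type*} [MeasurableSpace Ω] (P : Measure Ω) (κ : ℝ) {n : ℕ}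
    (B : Fin n → ℝ → Ω → ℝ) : Prop where
  isStandardFBM : ∀ i, IsStandardFBM P κ (B i)
  indep : iIndepFun (fun i ω t => B i t ω) P

/-- For a vector-valued process `Y` and a vector `d` of drift functions, the quantity
`𝓗_{Y,d}[-S₁, S₂] = ∫_{ℝⁿ} exp (∑ wᵢ) ℙ(∃ t ∈ [-S₁, S₂], √2 Y(t) - σ_Y²(t) - d(t) > w) dw`,
where vector inequalities are componentwise. The integrand is nonnegative, so the integral is
taken with values in `[0, ∞]`. -/
noncomputable def piterbargIntegral {Ω : Type*} [MeasurableSpace Ω] (P : Measure Ω) {n : ℕ}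
    (Y : Fin n → ℝ → Ω → ℝ) (d : Fin n → ℝ → ℝ) (S₁ S₂ : ℝ) : ℝ≥0∞ :=
  ∫⁻ w : Fin n → ℝ, ENNReal.ofReal (Real.exp (∑ i, w i)) *
    P {ω | ∃ t ∈ Set.Icc (-S₁) S₂, ∀ i, w i < √2 * Y i t ω - Var[Y i t; P] - d i t}

/-- `𝓗_Y(S) = 𝓗_{Y,0}[0, S]`. -/
noncomputable def pickandsIntegral {Ω : Type*} [MeasurableSpace Ω] (P : Measure Ω) {n : ℕ}
    (Y : Fin n → ℝ → Ω → ℝ) (S : ℝ) : ℝ≥0∞ :=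
  piterbargIntegral P Y (fun _ _ => 0) 0 S

/-- The `n`-dimensional Pickands constant `𝓗_Y = lim_{S → ∞} S⁻¹ 𝓗_Y(S)`. -/
noncomputable def pickandsConstant {Ω : Type*} [MeasurableSpace Ω] (P : Measure Ω) {n : ℕ}
    (Y : Fin n → ℝ → Ω → ℝ) : ℝ≥0∞ :=
  limUnder atTop fun S : ℝ => pickandsIntegral P Y S / ENNReal.ofReal S

/-- The defining limit `lim_{S → ∞} S⁻¹ 𝓗_Y(S)` exists in `[0, ∞]` (and hence equals
`pickandsConstant P Y`). -/
def PickandsLimitExists {Ω : Type*} [MeasurableSpace Ω] (P : Measure Ω) {n : ℕ}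
    (Y : Fin n → ℝ → Ω → ℝ) : Prop :=
  Tendsto (fun S : ℝ => pickandsIntegral P Y S / ENNReal.ofReal S) atTop
    (𝓝 (pickandsConstant P Y))

/-- The number `n / (n - 1)`, set to be `1` for `n = 1`. -/
noncomputable def ratio (n : ℕ) : ℝ := if n = 1 then 1 else (n : ℝ) / ((n : ℝ) - 1)

/-!
Write `X(t) = √2 B(t) - |t| ^ κ` for the drifted process, and let `V(I)` be the mean volume, for the
density `exp (∑ wᵢ)`, of the union over `t ∈ I` of the orthants below `X(t)`
(`orthantVolume`). Then the Pickands integral of `S` is `V([0, S])`.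

The set function `V` is subadditive by the union bound, and it is invariant under time shifts. For
`κ = 1` this is the Markov property of Brownian motion together with
`𝔼 exp (∑ Xᵢ(a)) = 1` (`IsVectorFBM.orthantVolume_shift`); for `κ = 2` the paths are the lines
`Bᵢ(t) = t Nᵢ`, and it is the Cameron–Martin formula for the Gaussian vector `N`
(`orthantVolume_parabola_shift`). By Fekete's lemma `V([0, S]) / S` converges to its infimum over
`S > 0`.

Hence every single `S` gives an upper bound. By independence `V([0, S])` is at most the `n`-th power
of its one-dimensional analogue (`IsVectorFBM.orthantVolume_le_prod`). If the latter is at most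
`a + b S`, then minimising `(a + b S) ^ n / S` over `S` yields `n b (n / (n - 1) a) ^ (n - 1)`,
attained at `S = a / (b (n - 1))` when `n ≥ 2` and approached as `S → ∞` when `n = 1`.

It remains to bound the one-dimensional volume `𝔼 exp (max X)`. For `κ = 2` the maximum over
`[0, S]` of `√2 t N - t ^ 2` is explicit and gives `1 + S / √π`. For `κ = 1` the upper bound in
the reflection principle for Brownian motion with drift is proved on grids, by induction on the
number of steps (`IsStandardFBM.measure_exists_le_crossingBound`), and integrates to
`2 + √(2 / (π e)) + S`.
-/

open scoped NNReal

section

variable {Ω : Type*} [MeasurableSpace Ω]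

/-! ### Subadditive functions and measurability in the corner of an orthant -/

/-- Fekete's lemma for monotone subadditive functions of a real variable. No finiteness is needed:
if the infimum is infinite the statement is trivial. -/
theorem tendsto_div_ofReal_of_subadditive {f : ℝ → ℝ≥0∞} (hmono : Monotone f)
    (hsub : ∀ s t, 0 ≤ s → 0 ≤ t → f (s + t) ≤ f s + f t) :
    Tendsto (fun S => f S / ENNReal.ofReal S) atTop
      (𝓝 (⨅ S : Set.Ioi (0 : ℝ), f S / ENNReal.ofReal S)) := by
  have hmul : ∀ T, 0 ≤ T → ∀ k : ℕ, f ((k + 1 : ℕ) * T) ≤ (k + 1 : ℕ) * f T := by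
    intro T hT k
    induction k with
    | zero => simp
    | succ k ih =>
      have h := hsub ((k + 1 : ℕ) * T) T (by positivity) hT
      calc f ((k + 1 + 1 : ℕ) * T) = f ((k + 1 : ℕ) * T + T) := by
            congr 1; push_cast; ring
        _ ≤ (k + 1 : ℕ) * f T + f T := h.trans (by gcongr)
        _ = (k + 1 + 1 : ℕ) * f T := by push_cast; ring
  refine tendsto_order.2 ⟨fun c hc => ?_, fun c hc => ?_⟩
  · filter_upwards [eventually_gt_atTop 0] with S hS
    exact hc.trans_le (iInf_le (fun S : Set.Ioi (0 : ℝ) => f S / ENNReal.ofReal S) ⟨S, hS⟩)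
  · obtain ⟨⟨T, hT⟩, hTc⟩ := iInf_lt_iff.1 hc
    have hT : 0 < T := hT
    have hT0 : ENNReal.ofReal T ≠ 0 := by simpa using hT
    have hfT : f T ≠ ∞ := by
      intro h
      simp [h, ENNReal.top_div] at hTc
    have hlim : Tendsto (fun S => f T / ENNReal.ofReal T + f T / ENNReal.ofReal S) atTop
        (𝓝 (f T / ENNReal.ofReal T + 0)) := by
      refine tendsto_const_nhds.add ?_
      have h1 : Tendsto (fun S => (ENNReal.ofReal S)⁻¹) atTop (𝓝 0) := by
        simpa using tendsto_inv_iff.2 ENNReal.tendsto_ofReal_atTop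
      have := ENNReal.Tendsto.const_mul (a := f T) h1 (Or.inr hfT)
      simpa [div_eq_mul_inv] using this
    have hlt := hlim.eventually_lt_const (by simpa using hTc)
    filter_upwards [hlt, eventually_gt_atTop 0] with S hS hS0
    refine lt_of_le_of_lt ?_ hS
    have hS00 : ENNReal.ofReal S ≠ 0 := by simpa using hS0
    -- cover `[0, S]` by `⌊S / T⌋ + 1` intervals of length `T`
    have hfloor : S ≤ (⌊S / T⌋₊ + 1 : ℕ) * T := by
      have := (Nat.lt_floor_add_one (S / T)).le
      rw [div_le_iff₀ hT] at this
      exact_mod_cast this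
    have hk : ((⌊S / T⌋₊ + 1 : ℕ) : ℝ≥0∞) ≤ ENNReal.ofReal (S / T) + 1 := by
      push_cast
      gcongr
      rw [← ENNReal.ofReal_natCast]
      exact ENNReal.ofReal_le_ofReal (Nat.floor_le (by positivity))
    calc f S / ENNReal.ofReal S
        ≤ ((ENNReal.ofReal (S / T) + 1) * f T) / ENNReal.ofReal S := by
          gcongr
          exact (hmono hfloor).trans ((hmul T hT.le _).trans (by gcongr))
      _ = f T / ENNReal.ofReal T + f T / ENNReal.ofReal S := by
          rw [add_mul, one_mul, ENNReal.add_div, ENNReal.ofReal_div_of_pos hT]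
          congr 1
          simp only [div_eq_mul_inv]
          calc _ = (ENNReal.ofReal S * (ENNReal.ofReal S)⁻¹) *
                (f T * (ENNReal.ofReal T)⁻¹) := by ring
            _ = _ := by rw [ENNReal.mul_inv_cancel hS00 ENNReal.ofReal_ne_top, one_mul]

/-- The probability that a family of random vectors enters a given open orthant depends lower
semicontinuously, hence measurably, on the corner of the orthant. The random vectors need
not be measurable, since only monotone unions of events are involved. -/
theorem lowerSemicontinuous_measure_exists_forall_lt {Ω ι J : Type*} [MeasurableSpace Ω]
    [Finite J] (P : Measure Ω) (f : ι → Ω → J → ℝ) :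
    LowerSemicontinuous fun w : J → ℝ => P {ω | ∃ t, ∀ j, w j < f t ω j} := by
  intro w c hc
  have hseq : {ω | ∃ t, ∀ j, w j < f t ω j} =
      ⋃ k : ℕ, {ω | ∃ t, ∀ j, w j + 1 / ((k : ℝ) + 1) < f t ω j} := by
    ext ω
    simp only [Set.mem_ofPred_eq, Set.mem_iUnion]
    constructor
    · rintro ⟨t, ht⟩
      have : ∀ᶠ k : ℕ in atTop, ∀ j, w j + 1 / ((k : ℝ) + 1) < f t ω j := by
        refine eventually_all.2 fun j => ?_
        have h := (tendsto_one_div_add_atTop_nhds_zero_nat (𝕜 := ℝ)).const_add (w j)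
        rw [add_zero] at h
        exact h.eventually_lt_const (ht j)
      obtain ⟨k, hk⟩ := this.exists
      exact ⟨k, t, hk⟩
    · rintro ⟨k, t, ht⟩
      exact ⟨t, fun j => lt_of_le_of_lt (le_add_of_nonneg_right (by positivity)) (ht j)⟩
  have hmono : Monotone fun k : ℕ => {ω | ∃ t, ∀ j, w j + 1 / ((k : ℝ) + 1) < f t ω j} := by
    rintro k l hkl ω ⟨t, ht⟩
    refine ⟨t, fun j => lt_of_le_of_lt ?_ (ht j)⟩
    have : 1 / ((l : ℝ) + 1) ≤ 1 / ((k : ℝ) + 1) := Nat.one_div_le_one_div hkl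
    linarith
  change c < P {ω | ∃ t, ∀ j, w j < f t ω j} at hc
  rw [hseq, hmono.measure_iUnion] at hc
  obtain ⟨k, hk⟩ := lt_iSup_iff.1 hc
  have hnear : ∀ᶠ w' : J → ℝ in 𝓝 w, ∀ j, w' j < w j + 1 / ((k : ℝ) + 1) := by
    refine eventually_all.2 fun j => ?_
    exact ((continuous_apply j).tendsto w).eventually_lt_const
      (lt_add_of_pos_right _ (by positivity))
  filter_upwards [hnear] with w' hw'
  refine hk.trans_le (measure_mono ?_)
  rintro ω ⟨t, ht⟩
  exact ⟨t, fun j => (hw' j).trans (ht j)⟩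

/-- Tonelli's theorem for products of functions of one coordinate. -/
theorem lintegral_pi_prod {n : ℕ} (μ : Fin n → Measure ℝ) [∀ i, SigmaFinite (μ i)]
    (f : Fin n → ℝ → ℝ≥0∞) (hf : ∀ i, Measurable (f i)) :
    ∫⁻ x, ∏ i, f i (x i) ∂(Measure.pi μ) = ∏ i, ∫⁻ x, f i x ∂(μ i) := by
  induction n with
  | zero => simp
  | succ n ih =>
    have h := (measurePreserving_piFinSuccAbove μ 0).symm
    rw [← h.lintegral_comp_emb (MeasurableEquiv.measurableEmbedding _)]
    simp only [MeasurableEquiv.piFinSuccAbove_symm_apply, Fin.prod_univ_succ,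
      Fin.insertNthEquiv_apply, Fin.insertNth_zero', Fin.cons_zero, Fin.cons_succ,
      Fin.succAbove_zero]
    rw [lintegral_prod_mul (f := f 0) (g := fun x : Fin n → ℝ => ∏ i, f i.succ (x i))
      (hf 0).aemeasurable (Finset.measurable_fun_prod _ fun i _ =>
        (hf i.succ).comp (measurable_pi_apply i)).aemeasurable,
      ih (fun i => μ i.succ) (fun i => f i.succ) fun i => hf i.succ]

theorem setLIntegral_Iio_exp (a : ℝ) :
    ∫⁻ w in Set.Iio a, ENNReal.ofReal (Real.exp w) = ENNReal.ofReal (Real.exp a) := by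
  rw [setLIntegral_congr Iio_ae_eq_Iic, ← ofReal_integral_eq_lintegral_ofReal,
    integral_exp_Iic]
  · exact integrableOn_exp_Iic a
  · exact Eventually.of_forall fun x => (Real.exp_pos x).le

/-- Exponential tilting (the Cameron–Martin formula on the line). -/
theorem lintegral_exp_mul_gaussianReal (m c : ℝ) (v : NNReal) (g : ℝ → ℝ≥0∞) :
    ∫⁻ x, ENNReal.ofReal (Real.exp (c * x - c * m - c ^ 2 * v / 2)) * g x ∂(gaussianReal m v) =
      ∫⁻ x, g x ∂(gaussianReal (m + c * v) v) := by
  by_cases hv : v = 0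
  · subst hv
    simp [gaussianReal_zero_var]
  rw [gaussianReal_of_var_ne_zero _ hv, gaussianReal_of_var_ne_zero _ hv,
    lintegral_withDensity_eq_lintegral_mul_non_measurable₀ _
      (measurable_gaussianPDF _ _).aemeasurable
      (Eventually.of_forall fun _ => gaussianPDF_lt_top),
    lintegral_withDensity_eq_lintegral_mul_non_measurable₀ _
      (measurable_gaussianPDF _ _).aemeasurable
      (Eventually.of_forall fun _ => gaussianPDF_lt_top)]
  refine lintegral_congr fun x => ?_
  simp only [Pi.mul_apply, gaussianPDF]
  rw [← mul_assoc, ← ENNReal.ofReal_mul (gaussianPDFReal_nonneg _ _ _)]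
  congr 2
  simp only [gaussianPDFReal]
  rw [mul_assoc, ← Real.exp_add]
  congr 2
  have : (v : ℝ) ≠ 0 := by exact_mod_cast hv
  field_simp
  ring

/-! ### Orthant volumes -/

/-- The mean volume `∫ exp (∑ wᵢ) ℙ(∃ t ∈ I, X(t) > w) dw` of the union over `t ∈ I` of the
orthants below `X(t)`, with respect to the density `exp (∑ wᵢ)`. -/
noncomputable def orthantVolume (P : Measure Ω) {n : ℕ} (X : Fin n → ℝ → Ω → ℝ) (I : Set ℝ) :
    ℝ≥0∞ :=
  ∫⁻ w : Fin n → ℝ, ENNReal.ofReal (Real.exp (∑ i, w i)) *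
    P {ω | ∃ t ∈ I, ∀ i, w i < X i t ω}

theorem measurable_measure_exists_mem_forall_lt (P : Measure Ω) {n : ℕ}
    (X : Fin n → ℝ → Ω → ℝ) (I : Set ℝ) :
    Measurable fun w : Fin n → ℝ => P {ω | ∃ t ∈ I, ∀ i, w i < X i t ω} := by
  have h := (lowerSemicontinuous_measure_exists_forall_lt P
    (fun (t : I) ω (i : Fin n) => X i t ω)).measurable
  simpa only [Subtype.exists, exists_prop] using h

theorem measurable_exp_sum {n : ℕ} :
    Measurable fun w : Fin n → ℝ => ENNReal.ofReal (Real.exp (∑ i, w i)) := by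
  fun_prop

theorem orthantVolume_mono (P : Measure Ω) {n : ℕ} (X : Fin n → ℝ → Ω → ℝ) {I J : Set ℝ}
    (h : I ⊆ J) : orthantVolume P X I ≤ orthantVolume P X J := by
  refine lintegral_mono fun w => ?_
  gcongr

theorem orthantVolume_union_le (P : Measure Ω) {n : ℕ} (X : Fin n → ℝ → Ω → ℝ) (I J : Set ℝ) :
    orthantVolume P X (I ∪ J) ≤ orthantVolume P X I + orthantVolume P X J := by
  unfold orthantVolume
  have hmeas : Measurable fun w : Fin n → ℝ => ENNReal.ofReal (Real.exp (∑ i, w i)) *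
      P {ω | ∃ t ∈ I, ∀ i, w i < X i t ω} :=
    measurable_exp_sum.mul (measurable_measure_exists_mem_forall_lt P X I)
  rw [← lintegral_add_left hmeas]
  refine lintegral_mono fun w => ?_
  simp only [← mul_add]
  gcongr
  refine (measure_mono ?_).trans (measure_union_le _ _)
  rintro ω ⟨t, ht | ht, hw⟩
  · exact Or.inl ⟨t, ht, hw⟩
  · exact Or.inr ⟨t, ht, hw⟩

/-- If the orthant volume is invariant under time shifts, then it is subadditive in the length of
the time interval, so that its growth rate exists and is an infimum. -/
theorem tendsto_orthantVolume_div (P : Measure Ω) {n : ℕ} (X : Fin n → ℝ → Ω → ℝ)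
    (hX : ∀ a S : ℝ, 0 ≤ a → 0 ≤ S →
      orthantVolume P X (Set.Icc a (a + S)) = orthantVolume P X (Set.Icc 0 S)) :
    Tendsto (fun S => orthantVolume P X (Set.Icc 0 S) / ENNReal.ofReal S) atTop
      (𝓝 (⨅ S : Set.Ioi (0 : ℝ), orthantVolume P X (Set.Icc 0 S) / ENNReal.ofReal S)) := by
  refine tendsto_div_ofReal_of_subadditive
    (f := fun S => orthantVolume P X (Set.Icc 0 S))
    (fun S T h => orthantVolume_mono P X (Set.Icc_subset_Icc_right h)) fun s t hs ht => ?_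
  rw [← Set.Icc_union_Icc_eq_Icc hs (le_add_of_nonneg_right ht), ← hX s t hs ht]
  exact orthantVolume_union_le _ _ _ _

/-! ### Reduction to stationarity and to dimension one -/

/-- The drifted process `√2 B(t) - |t|^κ` attached to a fractional Brownian motion. -/
noncomputable def driftedProcess (κ : ℝ) {n : ℕ} (B : Fin n → ℝ → Ω → ℝ) (i : Fin n) (t : ℝ)
    (ω : Ω) : ℝ :=
  √2 * B i t ω - |t| ^ κ

theorem IsStandardFBM.variance_eq {P : Measure Ω} {κ : ℝ} (hκ : κ ≠ 0) {X : ℝ → Ω → ℝ}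
    (hX : IsStandardFBM P κ X) (t : ℝ) : Var[X t; P] = |t| ^ κ := by
  rw [← covariance_self (hX.gaussian.aemeasurable t), hX.covariance]
  simp [Real.zero_rpow hκ]

theorem pickandsIntegral_eq_orthantVolume {P : Measure Ω} {κ : ℝ} (hκ : κ ≠ 0) {n : ℕ}
    {B : Fin n → ℝ → Ω → ℝ} (hB : IsVectorFBM P κ B) (S : ℝ) :
    pickandsIntegral P B S = orthantVolume P (driftedProcess κ B) (Set.Icc 0 S) := by
  simp only [pickandsIntegral, piterbargIntegral, orthantVolume, driftedProcess, neg_zero,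
    sub_zero, (hB.isStandardFBM _).variance_eq hκ]

theorem exists_dense_seq_Icc {S : ℝ} (hS : 0 ≤ S) :
    ∃ τ : ℕ → ℝ, (∀ k, τ k ∈ Set.Icc 0 S) ∧ Set.Icc 0 S ⊆ closure (Set.range τ) := by
  have : Nonempty (Set.Icc 0 S) := ⟨⟨0, le_refl _, hS⟩⟩
  obtain ⟨u, hu⟩ := TopologicalSpace.exists_dense_seq (Set.Icc 0 S)
  refine ⟨fun k => u k, fun k => (u k).2, fun t ht => ?_⟩
  have h := continuous_subtype_val.range_subset_closure_image_dense hu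
  rw [← Set.range_comp] at h
  exact h ⟨⟨t, ht⟩, rfl⟩

/-- A continuous path enters an open orthant during `[a, a + S]` if and only if it does so at
a time of a given dense subset of that interval. -/
theorem exists_mem_Icc_iff_exists_dense {n : ℕ} {x : Fin n → ℝ → ℝ} (hx : ∀ i, Continuous (x i))
    {a S : ℝ} {τ : ℕ → ℝ} (hτ : ∀ k, τ k ∈ Set.Icc 0 S)
    (hdense : Set.Icc 0 S ⊆ closure (Set.range τ)) (w : Fin n → ℝ) :
    (∃ t ∈ Set.Icc a (a + S), ∀ i, w i < x i t) ↔ ∃ k, ∀ i, w i < x i (a + τ k) := by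
  constructor
  · rintro ⟨t, ht, hw⟩
    have hopen : IsOpen {s : ℝ | ∀ i, w i < x i (a + s)} := by
      simp only [Set.ofPred_forall]
      exact isOpen_iInter_of_finite fun i =>
        isOpen_lt continuous_const ((hx i).comp (continuous_const.add continuous_id))
    have hmem : t - a ∈ closure (Set.range τ) :=
      hdense ⟨by linarith [ht.1], by linarith [ht.2]⟩
    obtain ⟨s, hs, ⟨k, rfl⟩⟩ := mem_closure_iff.1 hmem _ hopen
      (show ∀ i, w i < x i (a + (t - a)) by simpa using hw)
    exact ⟨k, hs⟩
  · rintro ⟨k, hk⟩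
    exact ⟨a + τ k, ⟨by linarith [(hτ k).1], by linarith [(hτ k).2]⟩, hk⟩

theorem IsVectorFBM.ae_continuous_driftedProcess {P : Measure Ω} {κ : ℝ} (hκ : 0 ≤ κ) {n : ℕ}
    {B : Fin n → ℝ → Ω → ℝ} (hB : IsVectorFBM P κ B) :
    ∀ᵐ ω ∂P, ∀ i, Continuous fun t => driftedProcess κ B i t ω := by
  refine ae_all_iff.2 fun i => ?_
  filter_upwards [(hB.isStandardFBM i).continuous_paths] with ω h
  exact (continuous_const.mul h).sub (continuous_abs.rpow_const fun _ => Or.inr hκ)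

theorem IsVectorFBM.measure_exists_mem_Icc_eq {P : Measure Ω} {κ : ℝ} (hκ : 0 ≤ κ) {n : ℕ}
    {B : Fin n → ℝ → Ω → ℝ} (hB : IsVectorFBM P κ B) {a S : ℝ} {τ : ℕ → ℝ}
    (hτ : ∀ k, τ k ∈ Set.Icc 0 S) (hdense : Set.Icc 0 S ⊆ closure (Set.range τ))
    (w : Fin n → ℝ) :
    P {ω | ∃ t ∈ Set.Icc a (a + S), ∀ i, w i < driftedProcess κ B i t ω} =
      P {ω | ∃ k, ∀ i, w i < driftedProcess κ B i (a + τ k) ω} := by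
  refine measure_congr ?_
  filter_upwards [hB.ae_continuous_driftedProcess hκ] with ω hω
  exact propext (exists_mem_Icc_iff_exists_dense hω hτ hdense w)

/-- If all coordinates exceed their levels simultaneously, each of them exceeds its own level at
some time, and these events are independent. -/
theorem IsVectorFBM.orthantVolume_le_prod {P : Measure Ω} {κ : ℝ} (hκ : 0 ≤ κ) {n : ℕ}
    {B : Fin n → ℝ → Ω → ℝ} (hB : IsVectorFBM P κ B) {S : ℝ} (hS : 0 ≤ S) :
    orthantVolume P (driftedProcess κ B) (Set.Icc 0 S) ≤
      ∏ i, ∫⁻ w : ℝ, ENNReal.ofReal (Real.exp w) *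
        P {ω | ∃ t ∈ Set.Icc 0 S, w < driftedProcess κ B i t ω} := by
  obtain ⟨τ, hτ, hdense⟩ := exists_dense_seq_Icc hS
  have hmeas : ∀ i, Measurable fun w : ℝ => ENNReal.ofReal (Real.exp w) *
      P {ω | ∃ t ∈ Set.Icc 0 S, w < driftedProcess κ B i t ω} := by
    intro i
    refine Measurable.mul (by fun_prop) (Antitone.measurable fun v w hvw => measure_mono ?_)
    rintro ω ⟨t, ht, hw⟩
    exact ⟨t, ht, hvw.trans_lt hw⟩
  unfold orthantVolume
  rw [volume_pi, ← lintegral_pi_prod _ _ hmeas]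
  refine lintegral_mono fun w => ?_
  simp only
  rw [Finset.prod_mul_distrib, Real.exp_sum, ENNReal.ofReal_prod_of_nonneg
    fun i _ => (Real.exp_pos _).le]
  gcongr
  have h0 := hB.measure_exists_mem_Icc_eq hκ (a := 0) hτ hdense w
  simp only [zero_add] at h0
  rw [h0]
  -- the events restricted to a countable set of times are measurable in the path
  let A : Fin n → Set (ℝ → ℝ) := fun i => {f | ∃ k, w i < √2 * f (τ k) - |τ k| ^ κ}
  have hA : ∀ i, MeasurableSet (A i) := by
    intro i
    simp only [A, Set.ofPred_exists]
    exact MeasurableSet.iUnion fun k => measurableSet_lt measurable_const (by fun_prop)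
  calc P {ω | ∃ k, ∀ i, w i < driftedProcess κ B i (τ k) ω}
      ≤ P (⋂ i ∈ Finset.univ, (fun ω t => B i t ω) ⁻¹' A i) := by
        refine measure_mono ?_
        rintro ω ⟨k, hk⟩
        simp only [Finset.mem_univ, Set.iInter_true, Set.mem_iInter]
        exact fun i => ⟨k, hk i⟩
    _ = ∏ i, P ((fun ω t => B i t ω) ⁻¹' A i) :=
        hB.indep.measure_inter_preimage_eq_mul _ fun i _ => hA i
    _ ≤ _ := by
        refine Finset.prod_le_prod' fun i _ => measure_mono ?_
        rintro ω ⟨k, hk⟩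
        exact ⟨τ k, hτ k, hk⟩

/-- Minimising `(a + b S) ^ n / S` over `S > 0`; for `n ≥ 2` the minimiser is
`S = a / (b (n - 1))`. -/
theorem iInf_ofReal_pow_div_le {n : ℕ} (hn : 1 ≤ n) {a b : ℝ} (ha : 0 < a) (hb : 0 < b) :
    ⨅ S : Set.Ioi (0 : ℝ), ENNReal.ofReal (a + b * S) ^ n / ENNReal.ofReal S ≤
      ENNReal.ofReal (n * (ratio n * a) ^ (n - 1) * b) := by
  rcases hn.eq_or_lt with rfl | hn
  · refine ge_of_tendsto (x := atTop) (f := fun S : ℝ => ENNReal.ofReal (a * S⁻¹ + b)) ?_ ?_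
    · have h := (tendsto_inv_atTop_zero (𝕜 := ℝ)).const_mul a |>.add_const b
      simpa using ENNReal.tendsto_ofReal h
    · filter_upwards [eventually_gt_atTop 0] with S hS
      refine (iInf_le _ ⟨S, hS⟩).trans ?_
      rw [pow_one, ← ENNReal.ofReal_div_of_pos hS]
      refine ENNReal.ofReal_le_ofReal (le_of_eq ?_)
      field_simp
  · have hn1 : (0 : ℝ) < n - 1 := by
      have : (1 : ℝ) < n := by exact_mod_cast hn
      linarith
    have hS : 0 < a / (b * (n - 1)) := by positivity
    refine (iInf_le _ ⟨a / (b * (n - 1)), hS⟩).trans ?_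
    rw [← ENNReal.ofReal_pow (by positivity), ← ENNReal.ofReal_div_of_pos hS]
    refine ENNReal.ofReal_le_ofReal (le_of_eq ?_)
    obtain ⟨m, rfl⟩ : ∃ m, n = m + 1 := ⟨n - 1, by omega⟩
    have hm : (m : ℝ) ≠ 0 := by
      push_cast at hn1
      linarith
    have h1 : a + b * (a / (b * ((m + 1 : ℕ) - 1))) = ratio (m + 1) * a := by
      rw [ratio, if_neg hn.ne']
      push_cast
      simp only [add_sub_cancel_right]
      field_simp
    rw [h1, pow_succ, Nat.add_sub_cancel, ratio, if_neg hn.ne']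
    push_cast
    simp only [add_sub_cancel_right]
    field_simp

/-- Existence of the Pickands constant and an upper bound for it follow from stationarity of the
orthant volume and an affine bound for the one-dimensional volumes. -/
theorem IsVectorFBM.pickands_of_stationary_of_le {P : Measure Ω} {κ : ℝ} (hκ : 0 < κ) {n : ℕ}
    (hn : 1 ≤ n) {B : Fin n → ℝ → Ω → ℝ} (hB : IsVectorFBM P κ B)
    (hstat : ∀ s S : ℝ, 0 ≤ s → 0 ≤ S →
      orthantVolume P (driftedProcess κ B) (Set.Icc s (s + S)) =
        orthantVolume P (driftedProcess κ B) (Set.Icc 0 S))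
    {a b : ℝ} (ha : 0 < a) (hb : 0 < b)
    (hle : ∀ i, ∀ S, 0 < S → ∫⁻ w : ℝ, ENNReal.ofReal (Real.exp w) *
      P {ω | ∃ t ∈ Set.Icc 0 S, w < driftedProcess κ B i t ω} ≤ ENNReal.ofReal (a + b * S)) :
    PickandsLimitExists P B ∧
      pickandsConstant P B ≤ ENNReal.ofReal (n * (ratio n * a) ^ (n - 1) * b) := by
  have hlim := tendsto_orthantVolume_div P _ hstat
  simp only [← pickandsIntegral_eq_orthantVolume hκ.ne' hB] at hlim
  refine ⟨tendsto_nhds_limUnder ⟨_, hlim⟩, ?_⟩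
  rw [show pickandsConstant P B = _ from hlim.limUnder_eq]
  refine le_trans ?_ (iInf_ofReal_pow_div_le hn ha hb)
  refine iInf_mono fun ⟨S, hS⟩ => ?_
  gcongr
  rw [pickandsIntegral_eq_orthantVolume hκ.ne' hB]
  refine (hB.orthantVolume_le_prod hκ.le (le_of_lt hS)).trans ?_
  refine (Finset.prod_le_prod' fun i _ => hle i S hS).trans ?_
  simp

/-! ### Gaussian tilting in several dimensions -/

/-- The layer-cake formula for `∫ exp M`. -/
theorem lintegral_exp_mul_measure_lt {E : Type*} [MeasurableSpace E] (μ : Measure E) [SFinite μ]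
    {M : E → ℝ} (hM : Measurable M) :
    ∫⁻ w : ℝ, ENNReal.ofReal (Real.exp w) * μ {x | w < M x} =
      ∫⁻ x, ENNReal.ofReal (Real.exp (M x)) ∂μ := by
  have hset : MeasurableSet {p : ℝ × E | p.1 < M p.2} :=
    measurableSet_lt measurable_fst (hM.comp measurable_snd)
  have h1 : ∀ w : ℝ, ENNReal.ofReal (Real.exp w) * μ {x | w < M x} =
      ∫⁻ x, {p : ℝ × E | p.1 < M p.2}.indicator
        (fun p => ENNReal.ofReal (Real.exp p.1)) (w, x) ∂μ := by
    intro w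
    have : (fun x => {p : ℝ × E | p.1 < M p.2}.indicator
        (fun p => ENNReal.ofReal (Real.exp p.1)) (w, x)) =
        {x | w < M x}.indicator fun _ => ENNReal.ofReal (Real.exp w) := by
      ext x
      simp [Set.indicator_apply]
    rw [this, lintegral_indicator_const (measurableSet_lt measurable_const hM)]
  simp only [h1]
  rw [lintegral_lintegral_swap]
  · refine lintegral_congr fun x => ?_
    rw [← setLIntegral_Iio_exp (M x), ← lintegral_indicator measurableSet_Iio]
    refine lintegral_congr fun w => ?_
    simp [Set.indicator_apply]
  · exact ((by fun_prop : Measurable fun p : ℝ × E =>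
      ENNReal.ofReal (Real.exp p.1)).indicator hset).aemeasurable

/-- Tilting all coordinates of a standard Gaussian vector by `c` moves every mean to `c`. -/
theorem pi_gaussianReal_withDensity {n : ℕ} (c : ℝ) :
    (Measure.pi fun _ : Fin n => gaussianReal 0 1).withDensity
      (fun x => ENNReal.ofReal (Real.exp (∑ i, (c * x i - c ^ 2 / 2)))) =
      Measure.pi fun _ : Fin n => gaussianReal c 1 := by
  symm
  refine Measure.pi_eq fun s hs => ?_
  rw [withDensity_apply _ (MeasurableSet.univ_pi hs),
    ← lintegral_indicator (MeasurableSet.univ_pi hs)]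
  have h : ∀ x : Fin n → ℝ, (Set.univ.pi s).indicator
      (fun x => ENNReal.ofReal (Real.exp (∑ i, (c * x i - c ^ 2 / 2)))) x =
      ∏ i, ENNReal.ofReal (Real.exp (c * x i - c ^ 2 / 2)) * (s i).indicator 1 (x i) := by
    intro x
    rw [Finset.prod_mul_distrib, ← ENNReal.ofReal_prod_of_nonneg
      fun i _ => (Real.exp_pos _).le, ← Real.exp_sum]
    by_cases hx : x ∈ Set.univ.pi s
    · rw [Set.indicator_of_mem hx, Finset.prod_congr rfl fun i _ =>
        Set.indicator_of_mem (hx i trivial) _]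
      simp
    · rw [Set.indicator_of_notMem hx]
      simp only [Set.mem_pi, Set.mem_univ, true_imp_iff, not_forall] at hx
      obtain ⟨i, hi⟩ := hx
      rw [Finset.prod_eq_zero (i := i) (Finset.mem_univ i) (Set.indicator_of_notMem hi _),
        mul_zero]
  simp only [h]
  rw [lintegral_pi_prod _ (fun i y => ENNReal.ofReal (Real.exp (c * y - c ^ 2 / 2)) *
    (s i).indicator 1 y)
    fun i => Measurable.mul (by fun_prop) (measurable_one.indicator (hs i))]
  refine Finset.prod_congr rfl fun i _ => ?_
  have h2 := lintegral_exp_mul_gaussianReal 0 c 1 ((s i).indicator 1)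
  simp only [mul_zero, sub_zero, NNReal.coe_one, mul_one, zero_add] at h2
  rw [h2, lintegral_indicator_one (hs i)]

/-- The Cameron–Martin formula for a shift of the standard Gaussian vector along the diagonal. -/
theorem lintegral_exp_sum_mul_comp_sub_pi_gaussianReal {n : ℕ} (c : ℝ) {K : (Fin n → ℝ) → ℝ≥0∞}
    (hK : Measurable K) :
    ∫⁻ x, ENNReal.ofReal (Real.exp (∑ i, (c * x i - c ^ 2 / 2))) * K (fun i => x i - c)
      ∂(Measure.pi fun _ : Fin n => gaussianReal 0 1) =
      ∫⁻ x, K x ∂(Measure.pi fun _ : Fin n => gaussianReal 0 1) := by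
  have hK' : Measurable fun x : Fin n → ℝ => K (fun i => x i - c) := hK.comp (by fun_prop)
  have h := lintegral_withDensity_eq_lintegral_mul
    (Measure.pi fun _ : Fin n => gaussianReal 0 1)
    (f := fun x => ENNReal.ofReal (Real.exp (∑ i, (c * x i - c ^ 2 / 2)))) (by fun_prop) hK'
  simp only [Pi.mul_apply] at h
  rw [← h, pi_gaussianReal_withDensity]
  have hmp : MeasurePreserving (fun (x : Fin n → ℝ) i => x i - c)
      (Measure.pi fun _ : Fin n => gaussianReal c 1)
      (Measure.pi fun _ : Fin n => gaussianReal 0 1) := by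
    refine measurePreserving_pi _ _ (f := fun _ y => y - c) fun i => ⟨by fun_prop, ?_⟩
    rw [gaussianReal_map_sub_const, sub_self]
  exact hmp.lintegral_comp hK

/-! ### Hurst index one -/

theorem IsStandardFBM.map_eq_gaussianReal {P : Measure Ω} {κ : ℝ} (hκ : κ ≠ 0) {X : ℝ → Ω → ℝ}
    (hX : IsStandardFBM P κ X) (t : ℝ) :
    P.map (X t) = gaussianReal 0 (|t| ^ κ).toNNReal := by
  rw [(hX.gaussian.hasGaussianLaw_eval t).map_eq_gaussianReal, hX.centered t,
    hX.variance_eq hκ]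

/-- Fractional Brownian motion with Hurst index `1` is a random line through the origin. -/
theorem IsStandardFBM.ae_eq_mul_eval_one {P : Measure Ω} [IsProbabilityMeasure P]
    {X : ℝ → Ω → ℝ} (hX : IsStandardFBM P 2 X) : ∀ᵐ ω ∂P, ∀ t, X t ω = t * X 1 ω := by
  have hL2 : ∀ t, MemLp (X t) 2 P := fun t => (hX.gaussian.hasGaussianLaw_eval t).memLp_two
  have h1 : ∀ t, ∀ᵐ ω ∂P, X t ω = t * X 1 ω := by
    intro t
    have hL2' : MemLp (fun ω => t * X 1 ω) 2 P := (hL2 1).const_mul t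
    have hvar : Var[fun ω => X t ω - t * X 1 ω; P] = 0 := by
      rw [variance_fun_sub (hL2 t) hL2', covariance_const_mul_right, hX.covariance,
        variance_const_mul, hX.variance_eq two_ne_zero, hX.variance_eq two_ne_zero]
      simp only [Real.rpow_two, sq_abs]
      ring
    filter_upwards [ae_eq_integral_of_variance_eq_zero ((hL2 t).sub hL2') hvar] with ω hω
    simp only [Pi.sub_apply] at hω
    rw [integral_sub ((hL2 t).integrable (by norm_num)) (hL2'.integrable (by norm_num)),
      integral_const_mul, hX.centered, hX.centered] at hω
    linarith
  have h2 : ∀ᵐ ω ∂P, ∀ q : ℚ, X q ω = q * X 1 ω := ae_all_iff.2 fun q => h1 q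
  filter_upwards [h2, hX.continuous_paths] with ω hω hc t
  exact congrFun (Continuous.ext_on Rat.denseRange_cast hc
    (continuous_id.mul continuous_const) (by rintro _ ⟨q, rfl⟩; exact hω q)) t

/-- The drifted process for Hurst index `1`, as a process on the space of slopes: the path with
slopes `x` has coordinates `√2 t xᵢ - t ^ 2`. -/
noncomputable def parabola {n : ℕ} (i : Fin n) (t : ℝ) (x : Fin n → ℝ) : ℝ :=
  √2 * (t * x i) - t ^ 2

theorem isOpen_exists_lt_parabola {n : ℕ} (I : Set ℝ) :
    IsOpen {p : (Fin n → ℝ) × (Fin n → ℝ) | ∃ t ∈ I, ∀ i, p.1 i < parabola i t p.2} := by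
  have : {p : (Fin n → ℝ) × (Fin n → ℝ) | ∃ t ∈ I, ∀ i, p.1 i < parabola i t p.2} =
      ⋃ t ∈ I, ⋂ i, {p | p.1 i < parabola i t p.2} := by
    ext p
    simp
  rw [this]
  refine isOpen_biUnion fun t _ => isOpen_iInter_of_finite fun i => isOpen_lt (by fun_prop) ?_
  unfold parabola
  fun_prop

/-- For Hurst index `1` the process depends only on its slopes `B 1`, which form a standard
Gaussian vector. -/
theorem IsVectorFBM.orthantVolume_eq_parabola {P : Measure Ω} [IsProbabilityMeasure P] {n : ℕ}
    {B : Fin n → ℝ → Ω → ℝ} (hB : IsVectorFBM P 2 B) (I : Set ℝ) :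
    orthantVolume P (driftedProcess 2 B) I =
      orthantVolume (Measure.pi fun _ : Fin n => gaussianReal 0 1) parabola I := by
  have hmeas : ∀ i, AEMeasurable (B i 1) P := fun i =>
    (hB.isStandardFBM i).gaussian.aemeasurable 1
  have hlaw : P.map (fun ω i => B i 1 ω) = Measure.pi fun _ : Fin n => gaussianReal 0 1 := by
    have hind : iIndepFun (fun i => B i 1) P :=
      hB.indep.comp (fun _ f => f 1) fun _ => measurable_pi_apply 1
    rw [hind.map_fun_eq_pi_map hmeas]
    congr 1
    ext1 i
    rw [(hB.isStandardFBM i).map_eq_gaussianReal two_ne_zero]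
    simp
  have hae : ∀ᵐ ω ∂P, ∀ i t, B i t ω = t * B i 1 ω :=
    ae_all_iff.2 fun i => (hB.isStandardFBM i).ae_eq_mul_eval_one
  unfold orthantVolume
  refine lintegral_congr fun w => ?_
  congr 1
  have hm : MeasurableSet {x : Fin n → ℝ | ∃ t ∈ I, ∀ i, w i < parabola i t x} :=
    ((isOpen_exists_lt_parabola I).preimage (Continuous.prodMk_right w)).measurableSet
  rw [← hlaw, Measure.map_apply_of_aemeasurable (aemeasurable_pi_lambda _ hmeas) hm]
  refine measure_congr ?_
  filter_upwards [hae] with ω hω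
  refine propext (exists_congr fun t => and_congr_right fun _ => forall_congr' fun i => ?_)
  rw [driftedProcess, hω i t, Real.rpow_two, sq_abs]
  rfl

/-- The density `exp (∑ wᵢ)`, restricted to the union of the open orthants below the points at
times `t ∈ I` of the parabolic curve with slopes `x`; a function of the pair `(w, x)`. -/
noncomputable def parabolaDensity {n : ℕ} (I : Set ℝ) : (Fin n → ℝ) × (Fin n → ℝ) → ℝ≥0∞ :=
  {p | ∃ t ∈ I, ∀ i, p.1 i < parabola i t p.2}.indicator
    fun p => ENNReal.ofReal (Real.exp (∑ i, p.1 i))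

theorem parabolaDensity_of_exists {n : ℕ} {I : Set ℝ} {w x : Fin n → ℝ}
    (h : ∃ t ∈ I, ∀ i, w i < parabola i t x) :
    parabolaDensity I (w, x) = ENNReal.ofReal (Real.exp (∑ i, w i)) :=
  Set.indicator_of_mem (s := {p : (Fin n → ℝ) × (Fin n → ℝ) |
    ∃ t ∈ I, ∀ i, p.1 i < parabola i t p.2}) (a := (w, x)) h _

theorem parabolaDensity_of_not_exists {n : ℕ} {I : Set ℝ} {w x : Fin n → ℝ}
    (h : ¬∃ t ∈ I, ∀ i, w i < parabola i t x) : parabolaDensity I (w, x) = 0 :=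
  Set.indicator_of_notMem (s := {p : (Fin n → ℝ) × (Fin n → ℝ) |
    ∃ t ∈ I, ∀ i, p.1 i < parabola i t p.2}) (a := (w, x)) h _

theorem measurable_parabolaDensity {n : ℕ} (I : Set ℝ) :
    Measurable (parabolaDensity I : (Fin n → ℝ) × (Fin n → ℝ) → ℝ≥0∞) :=
  Measurable.indicator (by fun_prop) (isOpen_exists_lt_parabola I).measurableSet

/-- The volume, for the density `exp (∑ wᵢ)`, of the union of the orthants below the points at
times `t ∈ I` of the parabolic curve with slopes `x`. -/
noncomputable def parabolaVolume {n : ℕ} (I : Set ℝ) (x : Fin n → ℝ) : ℝ≥0∞ :=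
  ∫⁻ w : Fin n → ℝ, parabolaDensity I (w, x)

theorem measurable_parabolaVolume {n : ℕ} (I : Set ℝ) :
    Measurable (parabolaVolume I : (Fin n → ℝ) → ℝ≥0∞) :=
  (measurable_parabolaDensity I).lintegral_prod_left'

theorem orthantVolume_parabola {n : ℕ} (μ : Measure (Fin n → ℝ)) [SFinite μ] (I : Set ℝ) :
    orthantVolume μ parabola I = ∫⁻ x, parabolaVolume I x ∂μ := by
  unfold orthantVolume parabolaVolume
  rw [lintegral_lintegral_swap (f := fun x w => parabolaDensity I (w, x))
    ((measurable_parabolaDensity I).comp measurable_swap).aemeasurable]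
  refine lintegral_congr fun w => ?_
  have hm : MeasurableSet {x : Fin n → ℝ | ∃ t ∈ I, ∀ i, w i < parabola i t x} :=
    ((isOpen_exists_lt_parabola I).preimage (Continuous.prodMk_right w)).measurableSet
  rw [← lintegral_indicator_const hm]
  refine lintegral_congr fun x => ?_
  simp only [parabolaDensity]
  rfl

/-- Moving the origin of time to `a` shifts the corners of the orthants, and replaces the slopes
`x` by `x - √2 a`. -/
theorem parabolaVolume_shift {n : ℕ} (a S : ℝ) (x : Fin n → ℝ) :
    parabolaVolume (Set.Icc a (a + S)) x =
      ENNReal.ofReal (Real.exp (∑ i, (√2 * a * x i - (√2 * a) ^ 2 / 2))) *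
        parabolaVolume (Set.Icc 0 S) fun i => x i - √2 * a := by
  have h2 : √2 * √2 = 2 := Real.mul_self_sqrt (by norm_num)
  have hm : Measurable fun w : Fin n → ℝ =>
      parabolaDensity (Set.Icc 0 S) (w, fun i => x i - √2 * a) :=
    (measurable_parabolaDensity _).comp measurable_prodMk_right
  unfold parabolaVolume
  rw [← lintegral_const_mul _ hm,
    ← lintegral_add_right_eq_self _ (fun i => √2 * a * x i - (√2 * a) ^ 2 / 2)]
  refine lintegral_congr fun w => ?_
  have hiff : (∃ t ∈ Set.Icc a (a + S), ∀ i,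
      w i + (√2 * a * x i - (√2 * a) ^ 2 / 2) < parabola i t x) ↔
      ∃ s ∈ Set.Icc 0 S, ∀ i, w i < parabola i s fun i => x i - √2 * a := by
    have key : ∀ s i, parabola i (a + s) x - (√2 * a * x i - (√2 * a) ^ 2 / 2) =
        parabola i s fun i => x i - √2 * a := by
      intro s i
      simp only [parabola]
      linear_combination (s * a + a ^ 2 / 2) * h2
    constructor
    · rintro ⟨t, ht, hw⟩
      refine ⟨t - a, ⟨by linarith [ht.1], by linarith [ht.2]⟩, fun i => ?_⟩
      rw [← key, add_sub_cancel]
      linarith [hw i]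
    · rintro ⟨s, hs, hw⟩
      refine ⟨a + s, ⟨by linarith [hs.1], by linarith [hs.2]⟩, fun i => ?_⟩
      have := hw i
      rw [← key] at this
      linarith
  change parabolaDensity _ (fun i => w i + (√2 * a * x i - (√2 * a) ^ 2 / 2), x) = _
  by_cases h : ∃ s ∈ Set.Icc 0 S, ∀ i, w i < parabola i s fun i => x i - √2 * a
  · rw [parabolaDensity_of_exists h, parabolaDensity_of_exists (hiff.2 h),
      ← ENNReal.ofReal_mul (Real.exp_pos _).le, ← Real.exp_add, ← Finset.sum_add_distrib]
    simp only [add_comm]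
  · rw [parabolaDensity_of_not_exists h, parabolaDensity_of_not_exists fun h' => h (hiff.1 h'),
      mul_zero]

/-- Stationarity for Hurst index `1`: the factor produced by moving the time origin is exactly the
Cameron–Martin density that compensates the shift of the slopes. -/
theorem orthantVolume_parabola_shift {n : ℕ} (a S : ℝ) :
    orthantVolume (Measure.pi fun _ : Fin n => gaussianReal 0 1) parabola (Set.Icc a (a + S)) =
      orthantVolume (Measure.pi fun _ : Fin n => gaussianReal 0 1) parabola (Set.Icc 0 S) := by
  simp only [orthantVolume_parabola, parabolaVolume_shift]
  exact lintegral_exp_sum_mul_comp_sub_pi_gaussianReal _ (measurable_parabolaVolume _)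

/-- The maximum over `t ∈ [0, S]` of `√2 t x - t ^ 2`. -/
noncomputable def parabolaMax (S x : ℝ) : ℝ :=
  if x ≤ 0 then 0 else if x < √2 * S then x ^ 2 / 2 else √2 * S * x - S ^ 2

theorem measurable_parabolaMax (S : ℝ) : Measurable (parabolaMax S) :=
  Measurable.ite measurableSet_Iic measurable_const
    (Measurable.ite measurableSet_Iio (by fun_prop) (by fun_prop))

theorem le_parabolaMax {S x t : ℝ} (ht : t ∈ Set.Icc 0 S) :
    √2 * (t * x) - t ^ 2 ≤ parabolaMax S x := by
  have h2 : √2 * √2 = 2 := Real.mul_self_sqrt (by norm_num)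
  have h0 : 0 < √2 := by positivity
  obtain ⟨ht0, htS⟩ := ht
  unfold parabolaMax
  split_ifs with h h'
  · have : √2 * (t * x) ≤ 0 :=
      mul_nonpos_of_nonneg_of_nonpos h0.le (mul_nonpos_of_nonneg_of_nonpos ht0 h)
    nlinarith [sq_nonneg t]
  · nlinarith [sq_nonneg (x - √2 * t)]
  · push Not at h'
    have h3 : 2 * S ≤ √2 * x := by nlinarith
    nlinarith [mul_nonneg (sub_nonneg.2 htS) (sub_nonneg.2 h3), sq_nonneg (S - t)]

/-- On `x ≤ 0` the integrand is `1`; on `(0, √2 S)` it cancels the Gaussian density up to the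
factor `1 / √(2π)`; on `x ≥ √2 S` it is the density of the shift by `√2 S`. The two outer parts
together have mass `1`. -/
theorem lintegral_exp_parabolaMax_le {S : ℝ} (hS : 0 < S) :
    ∫⁻ x, ENNReal.ofReal (Real.exp (parabolaMax S x)) ∂(gaussianReal 0 1) ≤
      ENNReal.ofReal (1 + 1 / √Real.pi * S) := by
  have h2 : √2 * √2 = 2 := Real.mul_self_sqrt (by norm_num)
  set c : ℝ := √2 * S with hc
  have hc0 : 0 < c := by positivity
  have hle : ∀ x, ENNReal.ofReal (Real.exp (parabolaMax S x)) ≤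
      (Set.Iic (0 : ℝ)).indicator 1 x +
      ((Set.Ioo 0 c).indicator (fun x => ENNReal.ofReal (Real.exp (x ^ 2 / 2))) x +
      ENNReal.ofReal (Real.exp (c * x - c * 0 - c ^ 2 * (1 : NNReal) / 2)) *
        (Set.Ici c).indicator 1 x) := by
    intro x
    unfold parabolaMax
    split_ifs with h h'
    · rw [Set.indicator_of_mem (s := Set.Iic (0 : ℝ)) h]
      simp
    · rw [Set.indicator_of_mem (s := Set.Ioo 0 c) ⟨not_le.1 h, h'⟩]
      exact le_add_left le_self_add
    · rw [Set.indicator_of_mem (s := Set.Ici c) (not_lt.1 h')]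
      refine le_add_left (le_add_left (le_of_eq ?_))
      have : c ^ 2 = 2 * S ^ 2 := by rw [hc]; linear_combination S ^ 2 * h2
      simp only [Pi.one_apply, mul_one, NNReal.coe_one, this]
      congr 2
      ring
  refine (lintegral_mono hle).trans ?_
  have hm1 : Measurable ((Set.Iic (0 : ℝ)).indicator (1 : ℝ → ℝ≥0∞)) :=
    measurable_one.indicator measurableSet_Iic
  have hm2 : Measurable ((Set.Ioo 0 c).indicator
      (fun x => ENNReal.ofReal (Real.exp (x ^ 2 / 2)))) :=
    Measurable.indicator (by fun_prop) measurableSet_Ioo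
  rw [lintegral_add_left hm1, lintegral_add_left hm2, lintegral_exp_mul_gaussianReal,
    lintegral_indicator_one measurableSet_Iic, lintegral_indicator_one measurableSet_Ici]
  have hthird : gaussianReal (0 + c * (1 : NNReal)) 1 (Set.Ici c) =
      gaussianReal 0 1 (Set.Ioi 0) := by
    have hna : NullSingletonClass (gaussianReal 0 1) := nullSingletonClass_gaussianReal one_ne_zero
    rw [← gaussianReal_map_add_const, Measure.map_apply (by fun_prop) measurableSet_Ici]
    rw [measure_congr Ioi_ae_eq_Ici]
    congr 1
    ext x
    simp
  have hsecond : ∫⁻ x, (Set.Ioo 0 c).indicator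
      (fun x => ENNReal.ofReal (Real.exp (x ^ 2 / 2))) x ∂(gaussianReal 0 1) =
      ENNReal.ofReal (1 / √Real.pi * S) := by
    rw [gaussianReal_of_var_ne_zero _ one_ne_zero,
      lintegral_withDensity_eq_lintegral_mul _ (measurable_gaussianPDF _ _) hm2]
    have : ∀ x, (gaussianPDF 0 1 * (Set.Ioo 0 c).indicator
        (fun x => ENNReal.ofReal (Real.exp (x ^ 2 / 2)))) x =
        (Set.Ioo 0 c).indicator (fun _ => ENNReal.ofReal ((√(2 * Real.pi))⁻¹)) x := by
      intro x
      by_cases hx : x ∈ Set.Ioo 0 c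
      · rw [Pi.mul_apply, Set.indicator_of_mem hx, Set.indicator_of_mem hx, gaussianPDF,
          ← ENNReal.ofReal_mul (gaussianPDFReal_nonneg _ _ _), gaussianPDFReal, mul_assoc,
          ← Real.exp_add]
        simp [neg_div]
      · simp [Set.indicator_of_notMem hx]
    simp only [this]
    rw [lintegral_indicator_const measurableSet_Ioo, Real.volume_Ioo, sub_zero,
      ← ENNReal.ofReal_mul (by positivity)]
    congr 1
    rw [hc, Real.sqrt_mul (by norm_num)]
    have : √Real.pi ≠ 0 := by positivity
    field_simp
  rw [hthird, hsecond, add_comm (ENNReal.ofReal _), ← add_assoc,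
    ← Set.compl_Iic, prob_add_prob_compl measurableSet_Iic,
    ENNReal.ofReal_add (by norm_num) (by positivity), ENNReal.ofReal_one]

/-- The one-dimensional volume for Hurst index `1` is at most `1 + S / √π`. -/
theorem IsStandardFBM.lintegral_exp_mul_measure_le {P : Measure Ω} [IsProbabilityMeasure P]
    {X : ℝ → Ω → ℝ} (hX : IsStandardFBM P 2 X) {S : ℝ} (hS : 0 < S) :
    ∫⁻ w : ℝ, ENNReal.ofReal (Real.exp w) *
        P {ω | ∃ t ∈ Set.Icc 0 S, w < √2 * X t ω - |t| ^ (2 : ℝ)} ≤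
      ENNReal.ofReal (1 + 1 / √Real.pi * S) := by
  refine le_trans ?_ (lintegral_exp_parabolaMax_le hS)
  rw [← lintegral_exp_mul_measure_lt _ (measurable_parabolaMax S)]
  refine lintegral_mono fun w => ?_
  have hlaw : P.map (X 1) = gaussianReal 0 1 := by
    rw [hX.map_eq_gaussianReal two_ne_zero]
    simp
  simp only
  gcongr
  rw [← hlaw, Measure.map_apply_of_aemeasurable (hX.gaussian.aemeasurable 1)
    (measurableSet_lt measurable_const (measurable_parabolaMax S))]
  refine measure_mono_ae ?_
  filter_upwards [hX.ae_eq_mul_eval_one] with ω hω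
  rintro ⟨t, ht, hw⟩
  rw [hω t, Real.rpow_two, sq_abs] at hw
  exact hw.trans_le (le_parabolaMax ht)

theorem IsVectorFBM.pickands_two {P : Measure Ω} [IsProbabilityMeasure P] {n : ℕ} (hn : 1 ≤ n)
    {B : Fin n → ℝ → Ω → ℝ} (hB : IsVectorFBM P 2 B) :
    PickandsLimitExists P B ∧ pickandsConstant P B ≤
      ENNReal.ofReal (n * ratio n ^ (n - 1) * (1 / √Real.pi)) := by
  have h := hB.pickands_of_stationary_of_le two_pos hn (a := 1) (b := 1 / √Real.pi)
    (fun s S _ _ => by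
      simp only [hB.orthantVolume_eq_parabola, orthantVolume_parabola_shift])
    one_pos (by positivity)
    (fun i S hS => (hB.isStandardFBM i).lintegral_exp_mul_measure_le hS)
  simpa only [mul_one] using h

/-! ### The crossing bound for Brownian motion with drift -/

theorem lintegral_gaussianReal_Ioi_sub (m₁ m₂ : ℝ) (v₁ v₂ : ℝ≥0) (w : ℝ) :
    ∫⁻ x, gaussianReal m₂ v₂ (Set.Ioi (w - x)) ∂(gaussianReal m₁ v₁) =
      gaussianReal (m₁ + m₂) (v₁ + v₂) (Set.Ioi w) := by
  rw [← gaussianReal_conv_gaussianReal, Measure.conv,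
    Measure.map_apply measurable_add measurableSet_Ioi,
    Measure.prod_apply (measurable_add measurableSet_Ioi)]
  refine lintegral_congr fun x => ?_
  congr 1
  ext y
  simp [sub_lt_iff_lt_add']

/-- The value that the reflection principle gives, for `w ≥ 0`, to the probability that
`√2 W(s) - s` exceeds `w` during `[0, t]`, where `W` is a Brownian motion. The same formula is
used for `w < 0`, where it is at least `1`; only its role as an upper bound matters. -/
noncomputable def crossingBound (t : ℝ≥0) (w : ℝ) : ℝ≥0∞ :=
  gaussianReal (-t) (2 * t) (Set.Ioi w) +
    ENNReal.ofReal (Real.exp (-w)) * gaussianReal t (2 * t) (Set.Ioi w)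

theorem measurable_gaussianReal_Ioi (m : ℝ) (v : ℝ≥0) :
    Measurable fun w : ℝ => gaussianReal m v (Set.Ioi w) :=
  Antitone.measurable fun _ _ h => measure_mono (Set.Ioi_subset_Ioi h)

/-- Below level `0` the bound is trivial: reflection gives the missing mass back, with a factor
`exp (-w) ≥ 1`. -/
theorem one_le_crossingBound (t : ℝ≥0) {w : ℝ} (hw : w < 0) : 1 ≤ crossingBound t w := by
  have h1 : gaussianReal (-t) (2 * t) (Set.Iic w) ≤ gaussianReal t (2 * t) (Set.Ioi w) := by
    have h := gaussianReal_map_neg (μ := (t : ℝ)) (v := 2 * t)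
    rw [← h, Measure.map_apply (by fun_prop) measurableSet_Iic]
    refine measure_mono fun x hx => ?_
    simp only [Set.mem_preimage, Set.mem_Iic, Set.mem_Ioi] at hx ⊢
    linarith
  have h2 : 1 ≤ ENNReal.ofReal (Real.exp (-w)) := by
    rw [ENNReal.one_le_ofReal]
    exact Real.one_le_exp (by linarith)
  calc (1 : ℝ≥0∞) = gaussianReal (-t) (2 * t) (Set.Ioi w) +
        gaussianReal (-t) (2 * t) (Set.Iic w) := by
        rw [← Set.compl_Ioi, prob_add_prob_compl measurableSet_Ioi]
    _ ≤ _ := by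
        unfold crossingBound
        gcongr
        exact h1.trans (le_mul_of_one_le_left' h2)

/-- The function `crossingBound` is harmonic for the space-time random walk with Gaussian steps
of mean `-δ` and variance `2δ`. -/
theorem lintegral_crossingBound_sub (δ t : ℝ≥0) (w : ℝ) :
    ∫⁻ x, crossingBound t (w - x) ∂(gaussianReal (-δ) (2 * δ)) = crossingBound (δ + t) w := by
  unfold crossingBound
  have hm : Measurable fun x : ℝ => gaussianReal (-t) (2 * t) (Set.Ioi (w - x)) :=
    (measurable_gaussianReal_Ioi _ _).comp (by fun_prop)
  rw [lintegral_add_left hm, lintegral_gaussianReal_Ioi_sub]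
  congr 1
  · push_cast
    ring_nf
  · have h := lintegral_exp_mul_gaussianReal (-δ) 1 (2 * δ)
      fun x => gaussianReal t (2 * t) (Set.Ioi (w - x))
    have h1 : (-δ : ℝ) + 1 * (2 * δ : ℝ≥0) = δ := by push_cast; ring
    rw [h1, lintegral_gaussianReal_Ioi_sub] at h
    rw [show ((δ + t : ℝ≥0) : ℝ) = δ + t by push_cast; rfl, mul_add, ← h,
      ← lintegral_const_mul' _ _ ENNReal.ofReal_ne_top]
    refine lintegral_congr fun x => ?_
    rw [← mul_assoc, ← ENNReal.ofReal_mul (Real.exp_pos _).le, ← Real.exp_add]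
    congr 3
    push_cast
    ring

theorem setLIntegral_Ioi_measure_Ioi (μ : Measure ℝ) :
    ∫⁻ w in Set.Ioi 0, μ (Set.Ioi w) = ∫⁻ y, ENNReal.ofReal y ∂μ := by
  have h := lintegral_eq_lintegral_meas_lt μ (f := fun y : ℝ => max y 0)
    (Eventually.of_forall fun y => le_max_right _ _) (by fun_prop)
  have h1 : ∀ y : ℝ, ENNReal.ofReal (max y 0) = ENNReal.ofReal y := by
    intro y
    rcases le_total 0 y with hy | hy
    · rw [max_eq_left hy]
    · rw [max_eq_right hy, ENNReal.ofReal_zero, ENNReal.ofReal_of_nonpos hy]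
  simp only [h1] at h
  rw [h]
  refine setLIntegral_congr_fun measurableSet_Ioi fun w hw => ?_
  congr 1
  ext y
  have hw : 0 < w := hw
  simp [hw.not_gt]

/-- The positive part of a Gaussian variable with mean `-S` and variance `2S` is at most
`2 S p(0)`, `p` being its density, because `y p(y) ≤ (y + S) p(y) = -(2 S p)'(y)` for `y > 0`.
The value `2 S p(0) = √(S / π) exp (-S / 4)` is largest at `S = 2`. -/
theorem lintegral_ofReal_gaussianReal_neg_le {S : ℝ≥0} (hS : 0 < S) :
    ∫⁻ y, ENNReal.ofReal y ∂(gaussianReal (-S) (2 * S)) ≤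
      ENNReal.ofReal (√(2 / (Real.pi * Real.exp 1))) := by
  have hS0 : (0 : ℝ) < S := hS
  have hv : 2 * S ≠ 0 := by positivity
  set p := gaussianPDFReal (-S) (2 * S) with hp
  have hderiv : ∀ y, HasDerivAt (fun y => -(2 * S) * p y) ((y + S) * p y) y := by
    intro y
    have h1 : HasDerivAt (fun y : ℝ => -(y - -(S : ℝ)) ^ 2 / (2 * (2 * S : ℝ≥0)))
        (-(2 * (y - -S)) / (2 * (2 * S : ℝ≥0))) y := by
      have := (((hasDerivAt_id y).sub_const (-(S : ℝ))).pow 2).neg.div_const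
        (2 * ((2 * S : ℝ≥0) : ℝ))
      simpa using this
    have h2 := (h1.exp.const_mul ((√(2 * Real.pi * (2 * S : ℝ≥0)))⁻¹)).const_mul (-(2 * (S : ℝ)))
    refine h2.congr_deriv ?_
    rw [hp, gaussianPDFReal]
    push_cast
    field_simp
    ring
  have hlim : Tendsto (fun y => -(2 * S) * p y) atTop (𝓝 0) := by
    have h1 : Tendsto (fun y : ℝ => -(y - -(S : ℝ)) ^ 2 / (2 * (2 * S : ℝ≥0))) atTop atBot := by
      have h2 : Tendsto (fun y : ℝ => (y - -(S : ℝ)) ^ 2 / (2 * (2 * S : ℝ≥0))) atTop atTop :=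
        ((tendsto_pow_atTop two_ne_zero).comp
          (tendsto_atTop_add_const_right _ _ tendsto_id)).atTop_div_const (by positivity)
      refine (tendsto_neg_atTop_atBot.comp h2).congr fun y => ?_
      simp [neg_div]
    have h3 := ((Real.tendsto_exp_atBot.comp h1).const_mul
      ((√(2 * Real.pi * (2 * S : ℝ≥0)))⁻¹)).const_mul (-(2 * (S : ℝ)))
    rw [mul_zero, mul_zero] at h3
    exact h3
  have hnn : ∀ y ∈ Set.Ioi (0 : ℝ), 0 ≤ (y + S) * p y := fun y hy =>
    mul_nonneg (add_nonneg (le_of_lt hy) hS0.le) (gaussianPDFReal_nonneg _ _ _)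
  calc ∫⁻ y, ENNReal.ofReal y ∂(gaussianReal (-S) (2 * S))
      = ∫⁻ y, gaussianPDF (-S) (2 * S) y * ENNReal.ofReal y := by
        rw [gaussianReal_of_var_ne_zero _ hv, lintegral_withDensity_eq_lintegral_mul _
          (measurable_gaussianPDF _ _) (by fun_prop)]
        rfl
    _ ≤ ∫⁻ y, (Set.Ioi (0 : ℝ)).indicator (fun y => ENNReal.ofReal ((y + S) * p y)) y := by
        refine lintegral_mono fun y => ?_
        by_cases hy : y ∈ Set.Ioi (0 : ℝ)
        · rw [Set.indicator_of_mem hy, gaussianPDF,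
            ← ENNReal.ofReal_mul (gaussianPDFReal_nonneg _ _ _), mul_comm]
          exact ENNReal.ofReal_le_ofReal (mul_le_mul_of_nonneg_right (by linarith)
            (gaussianPDFReal_nonneg _ _ _))
        · rw [Set.indicator_of_notMem hy, ENNReal.ofReal_of_nonpos (not_lt.1 hy), mul_zero]
    _ = ∫⁻ y in Set.Ioi (0 : ℝ), ENNReal.ofReal ((y + S) * p y) :=
        lintegral_indicator measurableSet_Ioi _
    _ = ENNReal.ofReal (2 * S * p 0) := by
        rw [← ofReal_integral_eq_lintegral_ofReal
          (integrableOn_Ioi_deriv_of_nonneg' (fun y _ => hderiv y) hnn hlim)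
          ((ae_restrict_iff' measurableSet_Ioi).2 (Eventually.of_forall hnn)),
          integral_Ioi_of_hasDerivAt_of_nonneg' (fun y _ => hderiv y) hnn hlim]
        congr 1
        ring
    _ ≤ _ := by
        refine ENNReal.ofReal_le_ofReal (Real.le_sqrt_of_sq_le ?_)
        have h1 : (2 * S * p 0) ^ 2 = S * Real.exp (-(S / 2)) / Real.pi := by
          rw [hp, gaussianPDFReal, mul_pow, mul_pow, mul_pow, inv_pow, Real.sq_sqrt (by positivity),
            ← Real.exp_nat_mul]
          push_cast
          have : (2 : ℝ) * (-(0 - -(S : ℝ)) ^ 2 / (2 * (2 * S))) = -(S / 2) := by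
            field_simp
            ring
          rw [this]
          field_simp
        have h2 := Real.add_one_le_exp ((S : ℝ) / 2 - 1)
        rw [h1, Real.exp_neg, div_le_div_iff₀ (by positivity) (by positivity)]
        rw [Real.exp_sub, le_div_iff₀ (Real.exp_pos _)] at h2
        have h3 : (S : ℝ) * Real.exp 1 * (Real.exp (S / 2))⁻¹ ≤ 2 := by
          rw [← div_eq_mul_inv, div_le_iff₀ (Real.exp_pos _)]
          linarith
        nlinarith [Real.pi_pos]

theorem lintegral_ofReal_gaussianReal_le {S : ℝ≥0} (hS : 0 < S) :
    ∫⁻ y, ENNReal.ofReal y ∂(gaussianReal S (2 * S)) ≤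
      ENNReal.ofReal (S + √(2 / (Real.pi * Real.exp 1))) := by
  have hint : Integrable (fun y : ℝ => y) (gaussianReal S (2 * S)) :=
    (memLp_id_gaussianReal 1).integrable (by simp)
  have h := integral_eq_lintegral_pos_part_sub_lintegral_neg_part hint
  rw [integral_id_gaussianReal] at h
  -- the negative part is the positive part of the reflected variable
  have hneg : ∫⁻ y, ENNReal.ofReal (-y) ∂(gaussianReal S (2 * S)) ≤
      ENNReal.ofReal (√(2 / (Real.pi * Real.exp 1))) := by
    refine le_trans (le_of_eq ?_) (lintegral_ofReal_gaussianReal_neg_le hS)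
    rw [← gaussianReal_map_neg, lintegral_map (by fun_prop) (by fun_prop)]
  have hfin : ∫⁻ y, ENNReal.ofReal y ∂(gaussianReal S (2 * S)) ≠ ∞ :=
    hint.lintegral_lt_top.ne
  rw [← ENNReal.ofReal_toReal hfin]
  refine ENNReal.ofReal_le_ofReal ?_
  have := ENNReal.toReal_mono ENNReal.ofReal_ne_top hneg
  rw [ENNReal.toReal_ofReal (by positivity)] at this
  linarith

/-- The range `w < 0` contributes `1`, and the two terms of `crossingBound` contribute at most the
exponential moment `1` of the first Gaussian law and the mean positive part of the second. -/
theorem lintegral_exp_mul_le_of_le_crossingBound {S : ℝ≥0} (hS : 0 < S) {p : ℝ → ℝ≥0∞}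
    (hp : ∀ w, p w ≤ 1) (hpS : ∀ w, p w ≤ crossingBound S w) :
    ∫⁻ w, ENNReal.ofReal (Real.exp w) * p w ≤
      ENNReal.ofReal (2 + √(2 / (Real.pi * Real.exp 1)) + 1 * S) := by
  have hsplit : ∫⁻ w, ENNReal.ofReal (Real.exp w) * p w ≤
      (∫⁻ w in Set.Iio 0, ENNReal.ofReal (Real.exp w)) +
      ((∫⁻ w, ENNReal.ofReal (Real.exp w) * gaussianReal (-S) (2 * S) {y | w < y}) +
        ∫⁻ w in Set.Ioi 0, gaussianReal S (2 * S) (Set.Ioi w)) := by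
    have hm1 : Measurable ((Set.Iio (0 : ℝ)).indicator fun w => ENNReal.ofReal (Real.exp w)) :=
      Measurable.indicator (by fun_prop) measurableSet_Iio
    have hm2 : Measurable fun w : ℝ =>
        ENNReal.ofReal (Real.exp w) * gaussianReal (-S) (2 * S) {y | w < y} :=
      Measurable.mul (by fun_prop) (measurable_gaussianReal_Ioi _ _)
    rw [setLIntegral_congr Ioi_ae_eq_Ici,
      ← lintegral_indicator measurableSet_Iio, ← lintegral_indicator measurableSet_Ici,
      ← lintegral_add_left hm2, ← lintegral_add_left hm1]
    refine lintegral_mono fun w => ?_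
    rcases lt_or_ge w 0 with hw | hw
    · rw [Set.indicator_of_mem (s := Set.Iio (0 : ℝ)) hw]
      exact (mul_le_of_le_one_right' (hp w)).trans le_self_add
    · rw [Set.indicator_of_mem (s := Set.Ici (0 : ℝ)) hw]
      refine le_add_left ((mul_le_mul_right (hpS w) _).trans (le_of_eq ?_))
      rw [crossingBound, mul_add, ← mul_assoc, ← ENNReal.ofReal_mul (Real.exp_pos _).le,
        ← Real.exp_add, add_neg_cancel, Real.exp_zero, ENNReal.ofReal_one, one_mul]
      rfl
  have hmid : ∫⁻ y, ENNReal.ofReal (Real.exp y) ∂(gaussianReal (-S) (2 * S)) = 1 := by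
    have h := lintegral_exp_mul_gaussianReal (-S) 1 (2 * S) 1
    simp only [Pi.one_apply, mul_one, lintegral_one, measure_univ] at h
    rw [← h]
    refine lintegral_congr fun y => ?_
    congr 2
    push_cast
    ring
  refine hsplit.trans ?_
  rw [setLIntegral_Iio_exp, Real.exp_zero, ENNReal.ofReal_one,
    lintegral_exp_mul_measure_lt _ measurable_id', hmid, setLIntegral_Ioi_measure_Ioi]
  calc 1 + (1 + ∫⁻ y, ENNReal.ofReal y ∂(gaussianReal S (2 * S)))
      ≤ 1 + (1 + ENNReal.ofReal (S + √(2 / (Real.pi * Real.exp 1)))) := by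
        gcongr
        exact lintegral_ofReal_gaussianReal_le hS
    _ = _ := by
        rw [← ENNReal.ofReal_one, ← ENNReal.ofReal_add (by norm_num) (by positivity),
          ← ENNReal.ofReal_add (by norm_num) (by positivity)]
        congr 1
        ring

/-! ### Brownian motion: stationarity -/

/-- The law of a Brownian motion observed along a sequence of times is determined. -/
theorem ProbabilityTheory.IsPreBrownianReal.map_comp_seq_eq {P : Measure Ω} {W W' : ℝ≥0 → Ω → ℝ}
    (hW : IsPreBrownianReal W P) (hW' : IsPreBrownianReal W' P) (τ : ℕ → ℝ≥0) :
    P.map (fun ω k => W (τ k) ω) = P.map (fun ω k => W' (τ k) ω) := by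
  have hP : IsProbabilityMeasure P := hW.isGaussianProcess.isProbabilityMeasure
  rw [map_eq_iff_forall_finset_map_restrict_eq (X := fun k => W (τ k)) (Y := fun k => W' (τ k))
    (aemeasurable_pi_lambda _ fun k => hW.aemeasurable _)
    (aemeasurable_pi_lambda _ fun k => hW'.aemeasurable _)]
  intro I
  classical
  let g : (I.image τ → ℝ) → I → ℝ := fun f k => f ⟨τ k, Finset.mem_image_of_mem τ k.2⟩
  have hg : Measurable g := by fun_prop
  have h1 := (hW.hasLaw (I.image τ))
  have h2 := (hW'.hasLaw (I.image τ))
  calc P.map (fun ω => I.restrict (fun k => W (τ k) ω))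
      = (P.map fun ω => (I.image τ).restrict (W · ω)).map g := by
        rw [AEMeasurable.map_map_of_aemeasurable hg.aemeasurable h1.aemeasurable]
        rfl
    _ = (P.map fun ω => (I.image τ).restrict (W' · ω)).map g := by
        rw [h1.map_eq, h2.map_eq]
    _ = _ := by
        rw [AEMeasurable.map_map_of_aemeasurable hg.aemeasurable h2.aemeasurable]
        rfl

/-- The Markov property of Brownian motion at a fixed time, along a sequence of times. -/
theorem ProbabilityTheory.IsPreBrownianReal.map_prodMk_shift_eq {P : Measure Ω} {W : ℝ≥0 → Ω → ℝ}
    (hW : IsPreBrownianReal W P) (a : ℝ≥0) (τ : ℕ → ℝ≥0) :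
    P.map (fun ω => (W a ω, fun k => W (a + τ k) ω - W a ω)) =
      (gaussianReal 0 a).prod (P.map fun ω k => W (τ k) ω) := by
  have hP : IsProbabilityMeasure P := hW.isGaussianProcess.isProbabilityMeasure
  have hind : IndepFun (W a) (fun ω k => W (a + τ k) ω - W a ω) P := by
    refine ((hW.indepFun_shift a).comp (φ := fun f (k : ℕ) => f (τ k))
      (ψ := fun f => f ⟨a, le_refl a⟩) ?_ ?_).symm <;> fun_prop
  have hm : AEMeasurable (fun ω (k : ℕ) => W (a + τ k) ω - W a ω) P :=
    aemeasurable_pi_lambda _ fun k => (hW.aemeasurable _).sub (hW.aemeasurable _)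
  rw [(indepFun_iff_map_prod_eq_prod_map_map (hW.aemeasurable a) hm).1 hind,
    (hW.hasLaw_eval a).map_eq, (hW.shift a).map_comp_seq_eq hW τ]

theorem IsStandardFBM.isPreBrownianReal {P : Measure Ω} {X : ℝ → Ω → ℝ}
    (hX : IsStandardFBM P 1 X) : IsPreBrownianReal (fun t : ℝ≥0 => X t) P := by
  refine (hX.gaussian.comp_right fun t : ℝ≥0 => (t : ℝ)).isPreBrownianReal_of_covariance
    (fun t => hX.centered t) fun s t hst => ?_
  have h : (s : ℝ) ≤ t := hst
  change cov[X s, X t; P] = s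
  rw [hX.covariance]
  simp only [Real.rpow_one]
  rw [NNReal.abs_eq, NNReal.abs_eq, abs_of_nonneg (sub_nonneg.2 h)]
  ring

/-- The Markov property at a fixed time for a vector of independent Brownian motions. -/
theorem IsVectorFBM.map_prodMk_shift_eq {P : Measure Ω} [IsProbabilityMeasure P] {n : ℕ}
    {B : Fin n → ℝ → Ω → ℝ} (hB : IsVectorFBM P 1 B) (a : ℝ≥0) (τ : ℕ → ℝ≥0) :
    P.map (fun ω => (fun i => B i a ω, fun i k => B i (a + τ k : ℝ≥0) ω - B i a ω)) =
      (Measure.pi fun _ : Fin n => gaussianReal 0 a).prod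
        (P.map fun ω i k => B i (τ k) ω) := by
  have hW : ∀ i, IsPreBrownianReal (fun t : ℝ≥0 => B i t) P := fun i =>
    (hB.isStandardFBM i).isPreBrownianReal
  have hm : ∀ i (t : ℝ≥0), AEMeasurable (B i t) P := fun i t => (hW i).aemeasurable t
  have hindZ : iIndepFun (fun i ω => (B i a ω, fun k => B i (a + τ k : ℝ≥0) ω - B i a ω)) P :=
    hB.indep.comp (fun _ f => (f a, fun k : ℕ => f (a + τ k : ℝ≥0) - f a)) fun _ => by fun_prop
  have hindV : iIndepFun (fun i ω k => B i (τ k) ω) P :=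
    hB.indep.comp (fun _ f k => f (τ k)) fun _ => by fun_prop
  have hmV : ∀ i, AEMeasurable (fun ω k => B i (τ k) ω) P := fun i =>
    aemeasurable_pi_lambda _ fun k => hm i _
  have hmZ : ∀ i, AEMeasurable
      (fun ω => (B i a ω, fun k => B i (a + τ k : ℝ≥0) ω - B i a ω)) P := fun i =>
    (hm i a).prodMk (aemeasurable_pi_lambda _ fun k => (hm i _).sub (hm i _))
  have hV : ∀ i, IsProbabilityMeasure (P.map fun ω k => B i (τ k) ω) := fun i =>
    Measure.isProbabilityMeasure_map (hmV i)
  have hmp := measurePreserving_arrowProdEquivProdArrow ℝ (ℕ → ℝ) (Fin n)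
    (fun _ => gaussianReal 0 a) (fun i => P.map fun ω k => B i (τ k) ω)
  rw [hindV.map_fun_eq_pi_map hmV, ← hmp.map_eq]
  have hlaw : P.map (fun ω i => (B i a ω, fun k => B i (a + τ k : ℝ≥0) ω - B i a ω)) =
      Measure.pi fun i => (gaussianReal 0 a).prod (P.map fun ω k => B i (τ k) ω) := by
    rw [hindZ.map_fun_eq_pi_map hmZ]
    congr 1
    ext1 i
    exact (hW i).map_prodMk_shift_eq a τ
  rw [← hlaw, AEMeasurable.map_map_of_aemeasurable
    (MeasurableEquiv.measurable _).aemeasurable (aemeasurable_pi_lambda _ hmZ)]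
  rfl

/-- Conditioning on `U`, when `V` is independent of `U` and has the law of `V'`. -/
theorem measure_prodMk_mem_eq_lintegral {E F : Type*} [MeasurableSpace E] [MeasurableSpace F]
    {P : Measure Ω} {U : Ω → E} {V V' : Ω → F} {μ : Measure E} [SFinite P]
    (hUV : AEMeasurable (fun ω => (U ω, V ω)) P) (hV' : AEMeasurable V' P)
    (h : P.map (fun ω => (U ω, V ω)) = μ.prod (P.map V')) {A : Set (E × F)}
    (hA : MeasurableSet A) :
    P {ω | (U ω, V ω) ∈ A} = ∫⁻ x, P {ω | (x, V' ω) ∈ A} ∂μ := by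
  have h1 : P {ω | (U ω, V ω) ∈ A} = P.map (fun ω => (U ω, V ω)) A :=
    (Measure.map_apply_of_aemeasurable hUV hA).symm
  rw [h1, h, Measure.prod_apply hA]
  refine lintegral_congr fun x => ?_
  rw [Measure.map_apply_of_aemeasurable hV' (measurable_prodMk_left hA)]
  rfl

/-- Restarting the vector process at time `a`. -/
theorem IsVectorFBM.measure_exists_shift_eq {P : Measure Ω} [IsProbabilityMeasure P] {n : ℕ}
    {B : Fin n → ℝ → Ω → ℝ} (hB : IsVectorFBM P 1 B) (a : ℝ≥0) (τ : ℕ → ℝ≥0)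
    (w : Fin n → ℝ) :
    P {ω | ∃ k, ∀ i, w i < driftedProcess 1 B i (a + τ k : ℝ≥0) ω} =
      ∫⁻ x, P {ω | ∃ k, ∀ i, w i - (√2 * x i - a) < driftedProcess 1 B i (τ k) ω}
        ∂(Measure.pi fun _ : Fin n => gaussianReal 0 a) := by
  have hm : ∀ i t, AEMeasurable (B i t) P := fun i t =>
    (hB.isStandardFBM i).gaussian.aemeasurable t
  let A : Set ((Fin n → ℝ) × (Fin n → ℕ → ℝ)) :=
    {p | ∃ k, ∀ i, w i - (√2 * p.1 i - a) < √2 * p.2 i k - τ k}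
  have hA : MeasurableSet A := by
    simp only [A, Set.ofPred_exists, Set.ofPred_forall]
    exact MeasurableSet.iUnion fun k => MeasurableSet.iInter fun i =>
      measurableSet_lt (by fun_prop) (by fun_prop)
  have h := measure_prodMk_mem_eq_lintegral (P := P)
    (U := fun ω i => B i a ω) (V := fun ω i k => B i (a + τ k : ℝ≥0) ω - B i a ω)
    (V' := fun ω i k => B i (τ k) ω)
    ((aemeasurable_pi_lambda _ fun i => hm i _).prodMk
      (aemeasurable_pi_lambda _ fun i => aemeasurable_pi_lambda _ fun k =>
        (hm i _).sub (hm i _)))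
    (aemeasurable_pi_lambda _ fun i => aemeasurable_pi_lambda _ fun k => hm i _)
    (hB.map_prodMk_shift_eq a τ) hA
  convert h using 2
  · ext ω
    refine exists_congr fun k => forall_congr' fun i => ?_
    rw [driftedProcess, Real.rpow_one, NNReal.abs_eq]
    simp only [NNReal.coe_add]
    constructor <;> intro h <;> linarith
  · ext x
    congr 1
    ext ω
    simp only [driftedProcess, Real.rpow_one, NNReal.abs_eq]
    rfl

/-- Stationarity for Hurst index `1 / 2`: the increments after time `a` are a copy of the process,
independent of the value at `a`, which only shifts the corners and contributes the factor
`𝔼 exp (∑ (√2 Bᵢ(a) - a)) = 1`. -/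
theorem IsVectorFBM.orthantVolume_shift {P : Measure Ω} [IsProbabilityMeasure P] {n : ℕ}
    {B : Fin n → ℝ → Ω → ℝ} (hB : IsVectorFBM P 1 B) {a S : ℝ} (ha : 0 ≤ a) (hS : 0 ≤ S) :
    orthantVolume P (driftedProcess 1 B) (Set.Icc a (a + S)) =
      orthantVolume P (driftedProcess 1 B) (Set.Icc 0 S) := by
  lift a to ℝ≥0 using ha
  obtain ⟨τ, hτ, hdense⟩ := exists_dense_seq_Icc hS
  lift τ to ℕ → ℝ≥0 using fun k => (hτ k).1
  set q : (Fin n → ℝ) → ℝ≥0∞ := fun w =>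
    P {ω | ∃ t ∈ Set.Icc 0 S, ∀ i, w i < driftedProcess 1 B i t ω} with hq
  have hqm : Measurable q := measurable_measure_exists_mem_forall_lt P _ _
  have hq' : ∀ w, q w = P {ω | ∃ k, ∀ i, w i < driftedProcess 1 B i (τ k) ω} := by
    intro w
    have h := hB.measure_exists_mem_Icc_eq zero_le_one (a := 0) hτ hdense w
    simpa only [zero_add] using h
  let c : (Fin n → ℝ) → Fin n → ℝ := fun x i => √2 * x i - a
  have hshift : ∀ w, P {ω | ∃ t ∈ Set.Icc (a : ℝ) (a + S), ∀ i, w i < driftedProcess 1 B i t ω} =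
      ∫⁻ x, q (w - c x) ∂(Measure.pi fun _ : Fin n => gaussianReal 0 a) := by
    intro w
    rw [hB.measure_exists_mem_Icc_eq zero_le_one hτ hdense w]
    have h := hB.measure_exists_shift_eq a τ w
    simp only [NNReal.coe_add] at h
    rw [h]
    simp only [hq']
    rfl
  have hexp : ∫⁻ x, ENNReal.ofReal (Real.exp (∑ i, c x i))
      ∂(Measure.pi fun _ : Fin n => gaussianReal 0 a) = 1 := by
    have h1 : ∀ x, ENNReal.ofReal (Real.exp (∑ i, c x i)) =
        ∏ i, ENNReal.ofReal (Real.exp (√2 * x i - a)) := by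
      intro x
      rw [Real.exp_sum, ENNReal.ofReal_prod_of_nonneg fun i _ => (Real.exp_pos _).le]
    simp only [h1]
    rw [lintegral_pi_prod _ (fun _ y => ENNReal.ofReal (Real.exp (√2 * y - a)))
      fun i => by fun_prop]
    refine Finset.prod_eq_one fun i _ => ?_
    have h2 := lintegral_exp_mul_gaussianReal 0 √2 a 1
    simpa using h2
  calc orthantVolume P (driftedProcess 1 B) (Set.Icc a (a + S))
      = ∫⁻ w : Fin n → ℝ, ∫⁻ x, ENNReal.ofReal (Real.exp (∑ i, w i)) * q (w - c x)
          ∂(Measure.pi fun _ : Fin n => gaussianReal 0 a) := by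
        unfold orthantVolume
        refine lintegral_congr fun w => ?_
        rw [hshift, lintegral_const_mul' _ _ ENNReal.ofReal_ne_top]
    _ = ∫⁻ x, (∫⁻ w : Fin n → ℝ, ENNReal.ofReal (Real.exp (∑ i, w i)) * q (w - c x))
          ∂(Measure.pi fun _ : Fin n => gaussianReal 0 a) := by
        refine lintegral_lintegral_swap (Measurable.aemeasurable ?_)
        refine Measurable.mul (by fun_prop) (hqm.comp ?_)
        fun_prop
    _ = ∫⁻ x, ENNReal.ofReal (Real.exp (∑ i, c x i)) *
          orthantVolume P (driftedProcess 1 B) (Set.Icc 0 S)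
          ∂(Measure.pi fun _ : Fin n => gaussianReal 0 a) := by
        refine lintegral_congr fun x => ?_
        rw [← lintegral_add_right_eq_self _ (c x)]
        unfold orthantVolume
        rw [← lintegral_const_mul' _ _ ENNReal.ofReal_ne_top]
        refine lintegral_congr fun w => ?_
        rw [add_sub_cancel_right, ← mul_assoc, ← ENNReal.ofReal_mul (Real.exp_pos _).le,
          ← Real.exp_add, ← Finset.sum_add_distrib]
        simp only [Pi.add_apply, add_comm]
        rfl
    _ = _ := by
        rw [lintegral_mul_const _ (by fun_prop), hexp, one_mul]

/-! ### Brownian motion: the one-dimensional bound -/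

/-- Conditioning the drifted random walk `√2 W(k δ) - k δ` on its first step. -/
theorem IsStandardFBM.measure_exists_shift_eq {P : Measure Ω} [IsProbabilityMeasure P]
    {X : ℝ → Ω → ℝ} (hX : IsStandardFBM P 1 X) (δ : ℝ≥0) (N : ℕ) (w : ℝ) :
    P {ω | ∃ k : ℕ, k ≤ N ∧ w < √2 * X ((k + 1 : ℕ) * δ) ω - (k + 1 : ℕ) * δ} =
      ∫⁻ x, P {ω | ∃ k : ℕ, k ≤ N ∧ w - x < √2 * X (k * δ) ω - k * δ}
        ∂(gaussianReal (-δ) (2 * δ)) := by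
  have hm : ∀ t, AEMeasurable (X t) P := hX.gaussian.aemeasurable
  let A : Set (ℝ × (ℕ → ℝ)) :=
    {p | ∃ k : ℕ, k ≤ N ∧ w - (√2 * p.1 + -δ) < √2 * p.2 k - k * δ}
  have hA : MeasurableSet A := by
    simp only [A, Set.ofPred_exists, Set.ofPred_and]
    exact MeasurableSet.iUnion fun k => (MeasurableSet.const _).inter
      (measurableSet_lt (by fun_prop) (by fun_prop))
  have h := measure_prodMk_mem_eq_lintegral (P := P)
    (U := X δ) (V := fun ω (k : ℕ) => X (δ + (k * δ : ℝ≥0) : ℝ≥0) ω - X δ ω)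
    (V' := fun ω (k : ℕ) => X (k * δ : ℝ≥0) ω)
    ((hm _).prodMk (aemeasurable_pi_lambda _ fun k => (hm _).sub (hm _)))
    (aemeasurable_pi_lambda _ fun k => hm _)
    (hX.isPreBrownianReal.map_prodMk_shift_eq δ fun k => k * δ) hA
  have hmap : (gaussianReal 0 δ).map (fun x => √2 * x + -δ) = gaussianReal (-δ) (2 * δ) := by
    have h1 : (fun x : ℝ => √2 * x + -(δ : ℝ)) = (fun x => x + -(δ : ℝ)) ∘ (fun x => √2 * x) := rfl
    rw [h1, ← Measure.map_map (by fun_prop) (by fun_prop), gaussianReal_map_const_mul,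
      gaussianReal_map_add_const]
    congr 1
    · simp
    · ext
      simp
  have hmeas : Measurable fun x : ℝ =>
      P {ω | ∃ k : ℕ, k ≤ N ∧ w - x < √2 * X (k * δ) ω - k * δ} := by
    refine Monotone.measurable fun x y hxy => measure_mono ?_
    rintro ω ⟨k, hk, hw⟩
    exact ⟨k, hk, by linarith⟩
  rw [← hmap, lintegral_map hmeas (by fun_prop)]
  convert h using 2
  · ext ω
    refine exists_congr fun k => and_congr_right fun _ => ?_
    have : ((k + 1 : ℕ) : ℝ) * δ = δ + k * δ := by push_cast; ring
    simp only [this, NNReal.coe_add, NNReal.coe_mul, NNReal.coe_natCast]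
    constructor <;> intro h <;> linarith
  · ext x
    congr 1

/-- A discrete form of the upper bound in the reflection principle, by induction on the number of
steps: `crossingBound` is harmonic for the walk and dominates the exit value `1` below level `0`. -/
theorem IsStandardFBM.measure_exists_le_crossingBound {P : Measure Ω} [IsProbabilityMeasure P]
    {X : ℝ → Ω → ℝ} (hX : IsStandardFBM P 1 X) (δ : ℝ≥0) (N : ℕ) (w : ℝ) :
    P {ω | ∃ k : ℕ, k ≤ N ∧ w < √2 * X (k * δ) ω - k * δ} ≤ crossingBound (N * δ) w := by
  have h0 : ∀ w, 0 ≤ w → P {ω | w < √2 * X 0 ω} = 0 := by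
    intro w hw
    refine measure_eq_zero_iff_ae_notMem.2 ?_
    filter_upwards [hX.isPreBrownianReal.eval_zero_ae_eq_zero] with ω hω
    have hω : X 0 ω = 0 := hω
    simp [hω, hw]
  induction N generalizing w with
  | zero =>
    rcases lt_or_ge w 0 with hw | hw
    · exact prob_le_one.trans (one_le_crossingBound _ hw)
    refine le_of_eq_of_le ?_ zero_le
    rw [← h0 w hw]
    congr 1
    ext ω
    simp
  | succ N ih =>
    rcases lt_or_ge w 0 with hw | hw
    · exact prob_le_one.trans (one_le_crossingBound _ hw)
    calc P {ω | ∃ k : ℕ, k ≤ N + 1 ∧ w < √2 * X (k * δ) ω - k * δ}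
        ≤ P {ω | w < √2 * X 0 ω} +
          P {ω | ∃ k : ℕ, k ≤ N ∧ w < √2 * X ((k + 1 : ℕ) * δ) ω - (k + 1 : ℕ) * δ} := by
          refine (measure_mono ?_).trans (measure_union_le _ _)
          rintro ω ⟨k, hk, hkw⟩
          rcases k with _ | k
          · left
            simpa using hkw
          · exact Or.inr ⟨k, by omega, hkw⟩
      _ ≤ ∫⁻ x, crossingBound (N * δ) (w - x) ∂(gaussianReal (-δ) (2 * δ)) := by
          rw [h0 w hw, zero_add, hX.measure_exists_shift_eq]
          exact lintegral_mono fun x => ih _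
      _ = crossingBound ((N + 1 : ℕ) * δ) w := by
          rw [lintegral_crossingBound_sub]
          congr 1
          push_cast
          ring

/-- The bound passes from grids to `[0, S]`: a continuous path that exceeds `w` does so on all
sufficiently fine grids. -/
theorem IsStandardFBM.measure_exists_Icc_le_crossingBound {P : Measure Ω}
    [IsProbabilityMeasure P] {X : ℝ → Ω → ℝ} (hX : IsStandardFBM P 1 X) {S : ℝ≥0} (hS : 0 < S)
    (w : ℝ) :
    P {ω | ∃ t ∈ Set.Icc (0 : ℝ) S, w < √2 * X t ω - |t| ^ (1 : ℝ)} ≤ crossingBound S w := by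
  have hS0 : (0 : ℝ) < S := hS
  let A : ℕ → Set Ω := fun m =>
    {ω | ∃ k : ℕ, k ≤ m + 1 ∧ w < √2 * X (k * (S / (m + 1 : ℕ) : ℝ≥0)) ω -
      k * (S / (m + 1 : ℕ) : ℝ≥0)}
  have hA : ∀ m, P (A m) ≤ crossingBound S w := by
    intro m
    refine (hX.measure_exists_le_crossingBound (S / (m + 1 : ℕ)) (m + 1) w).trans (le_of_eq ?_)
    congr 1
    field_simp
  have hmono : Monotone fun M => ⋂ m ≥ M, A m := fun M M' h =>
    Set.biInter_subset_biInter_left fun m hm => le_trans h hm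
  have hlim : P (⋃ M, ⋂ m ≥ M, A m) ≤ crossingBound S w := by
    rw [hmono.measure_iUnion]
    exact iSup_le fun M => (measure_mono (Set.biInter_subset_of_mem (le_refl M))).trans (hA M)
  refine le_trans (measure_mono_ae ?_) hlim
  filter_upwards [hX.continuous_paths] with ω hω
  rintro ⟨t, ht, hw⟩
  -- the grid points `⌊t (m + 1) / S⌋ S / (m + 1)` converge to `t`
  have hgrid : Tendsto (fun m : ℕ => (⌊t / S * (m + 1 : ℕ)⌋₊ : ℝ) * (S / (m + 1 : ℕ) : ℝ≥0))
      atTop (𝓝 t) := by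
    have h1 := ((tendsto_nat_floor_mul_div_atTop (R := ℝ) (a := t / S)
      (div_nonneg ht.1 hS0.le)).comp
      (tendsto_natCast_atTop_atTop.comp (tendsto_add_atTop_nat 1))).mul_const (S : ℝ)
    rw [div_mul_cancel₀ _ hS0.ne'] at h1
    refine h1.congr fun m => ?_
    simp only [Function.comp_apply, NNReal.coe_div, NNReal.coe_natCast]
    ring
  have hcont : Continuous fun s => √2 * X s ω - s := (continuous_const.mul hω).sub continuous_id
  rw [Real.rpow_one, abs_of_nonneg ht.1] at hw
  have hev := ((hcont.tendsto t).comp hgrid).eventually_const_lt hw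
  obtain ⟨M, hM⟩ := eventually_atTop.1 hev
  refine Set.mem_iUnion.2 ⟨M, Set.mem_iInter₂.2 fun m hm => ⟨_, ?_, hM m hm⟩⟩
  refine Nat.floor_le_of_le ?_
  exact mul_le_of_le_one_left (by positivity) ((div_le_one hS0).2 ht.2)

theorem IsVectorFBM.pickands_one {P : Measure Ω} [IsProbabilityMeasure P] {n : ℕ} (hn : 1 ≤ n)
    {B : Fin n → ℝ → Ω → ℝ} (hB : IsVectorFBM P 1 B) :
    PickandsLimitExists P B ∧ pickandsConstant P B ≤ ENNReal.ofReal
      (n * (ratio n * (2 + √(2 / (Real.pi * Real.exp 1)))) ^ (n - 1)) := by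
  have h := hB.pickands_of_stationary_of_le one_pos hn
    (a := 2 + √(2 / (Real.pi * Real.exp 1))) (b := 1)
    (fun s S hs hS => hB.orthantVolume_shift hs hS) (by positivity) one_pos
    fun i S hS => by
      lift S to ℝ≥0 using hS.le
      exact lintegral_exp_mul_le_of_le_crossingBound hS (fun w => prob_le_one) fun w =>
        (hB.isStandardFBM i).measure_exists_Icc_le_crossingBound hS w
  simpa only [mul_one] using h

end

theorem proposition3p3 (n : ℕ) (hn : 1 ≤ n) {Ω : Type*} [MeasurableSpace Ω]
    (P : Measure Ω) [IsProbabilityMeasure P] :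
    (∀ B : Fin n → ℝ → Ω → ℝ, IsVectorFBM P 1 B →
      PickandsLimitExists P B ∧
      pickandsConstant P B ≤ ENNReal.ofReal
        (n * (ratio n * (2 + √(2 / (Real.pi * Real.exp 1)))) ^ (n - 1))) ∧
    (∀ B : Fin n → ℝ → Ω → ℝ, IsVectorFBM P 2 B →
      PickandsLimitExists P B ∧
      pickandsConstant P B ≤ ENNReal.ofReal
        (n * ratio n ^ (n - 1) * (1 / √Real.pi))) := by
  exact ⟨fun _ hB => hB.pickands_one hn, fun _ hB => hB.pickands_two hn⟩
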